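/- Let $z=x+iy$ denote a variable in the upper half plane $\mathfrak H$, $q=e^{2\pi i z}$ and $\mathbb L=\log|q|=i\pi(z-\overline z)=-2\pi y$. For integers $r,s$ let $\mathcal M_{r,s}$ be the space of real analytic functions $f:\mathfrak H\to\mathbb C$ such that $f(\gamma z)=(cz+d)^r(c\overline z+d)^s f(z)$ for all $\gamma=\begin{pmatrix}a&b\\c&d\end{pmatrix}\in \mathrm{SL}_2(\mathbb Z)$ and such that, for some $N\in\mathbb N$, $$f=\sum_{k=-N}^{N}\mathbb L^k\sum_{m,n\ge 0}a^{(k)}_{m,n}\,q^m\overline q^{\,n},\qquad a^{(k)}_{m,n}\in\mathbb C,$$ where the power series converge on $\mathfrak H$; let $P^p\mathcal M_{r,s}$ be the subspace of those $f$ with $a^{(k)}_{m,n}=0$ for all $k<p$. On $\mathcal M_{r,s}$ let $\partial=(z-\overline z)\frac{\partial}{\partial z}+r$ and $\overline\partial=(\overline z-z)\frac{\partial}{\partial\overline z}+s$. For even $k\ge4$ let $\mathbb G_k=-\frac{b_k}{2k}+\sum_{n\ge1}\sigma_{k-1}(n)q^n$, where $b_k$ is the $k$-th Bernoulli number and $\sigma_{k-1}(n)=\sum_{d\mid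 n}d^{k-1}$. **Proposition.** For every even integer $w\ge 1$ there exists a unique family of functions $\mathcal E_{r,s}\in P^{-w}\mathcal M_{r,s}$, indexed by the integers $r,s\ge0$ with $r+s=w$, such that $$\partial\mathcal E_{w,0}=\mathbb L\,\mathbb G_{w+2},\qquad \partial\mathcal E_{r,s}=(r+1)\,\mathcal E_{r+1,s-1}\quad(1\le s\le w),$$ $$\overline\partial\mathcal E_{0,w}=\mathbb L\,\overline{\mathbb G_{w+2}},\qquad \overline\partial\mathcal E_{r,s}=(s+1)\,\mathcal E_{r-1,s+1}\quad(1\le r\le w).$$ These functions are given explicitly by the absolutely convergent sums $$\mathcal E_{r,s}(z)=\frac{w!}{(2\pi i)^{w+2}}\,\frac12\sum_{(m,n)\in\mathbb Z^2\setminus\{(0,0)\}}\frac{\mathbb L}{(mz+n)^{r+1}(m\overline z+n)^{s+1}}.$$ -/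

import Mathlib

open UpperHalfPlane

noncomputable section

namespace RealAnalyticEisenstein

/-- The Wirtinger derivative `∂f/∂z = (∂f/∂x - i ∂f/∂y) / 2` of a function on the upper
half plane. -/
def wirtinger (f : ℍ → ℂ) (z : ℍ) : ℂ :=
  (fderiv ℝ (fun u : ℂ => f (ofComplex u)) (z : ℂ) 1
    - Complex.I * fderiv ℝ (fun u : ℂ => f (ofComplex u)) (z : ℂ) Complex.I) / 2

/-- The Wirtinger derivative `∂f/∂z̄ = (∂f/∂x + i ∂f/∂y) / 2` of a function on the upper
half plane. -/
def wirtingerBar (f : ℍ → ℂ) (z : ℍ) : ℂ :=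
  (fderiv ℝ (fun u : ℂ => f (ofComplex u)) (z : ℂ) 1
    + Complex.I * fderiv ℝ (fun u : ℂ => f (ofComplex u)) (z : ℂ) Complex.I) / 2

/-- The operator `∂_r = (z - z̄) ∂/∂z + r`. -/
def partialOp (r : ℤ) (f : ℍ → ℂ) : ℍ → ℂ := fun z =>
  ((z : ℂ) - starRingEnd ℂ (z : ℂ)) * wirtinger f z + (r : ℂ) * f z

/-- The operator `∂̄_s = (z̄ - z) ∂/∂z̄ + s`. -/
def partialBarOp (s : ℤ) (f : ℍ → ℂ) : ℍ → ℂ := fun z =>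
  (starRingEnd ℂ (z : ℂ) - (z : ℂ)) * wirtingerBar f z + (s : ℂ) * f z

/-- `q = exp(2πiz)`. -/
def qq (z : ℍ) : ℂ := Complex.exp (2 * Real.pi * Complex.I * (z : ℂ))

/-- `𝕃 = log |q| = iπ(z - z̄) = -2πy`. -/
def LL (z : ℍ) : ℂ := Complex.I * Real.pi * ((z : ℂ) - starRingEnd ℂ (z : ℂ))

/-- `f` is real analytic on the upper half plane. -/
def IsRealAnalytic (f : ℍ → ℂ) : Prop :=
  AnalyticOnNhd ℝ (fun u : ℂ => f (ofComplex u)) {u : ℂ | 0 < u.im}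

/-- `f(γz) = (cz+d)^r (cz̄+d)^s f(z)` for all `γ = (a b; c d)` in `SL₂(ℤ)`. -/
def IsModular (r s : ℤ) (f : ℍ → ℂ) : Prop :=
  ∀ (γ : Matrix.SpecialLinearGroup (Fin 2) ℤ) (z : ℍ),
    f (γ • z) = ((γ 1 0 : ℂ) * (z : ℂ) + (γ 1 1 : ℂ)) ^ r
      * ((γ 1 0 : ℂ) * starRingEnd ℂ (z : ℂ) + (γ 1 1 : ℂ)) ^ s * f z

/-- `f = ∑_{k=-N}^{N} 𝕃^k ∑_{m,n ≥ 0} a k m n q^m q̄^n` on the upper half plane, the coefficient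
of each power of `𝕃` being a power series in `q, q̄` that converges there. -/
def HasExpansion (f : ℍ → ℂ) (N : ℕ) (a : ℤ → ℕ → ℕ → ℂ) : Prop :=
  ∀ z : ℍ,
    (∀ k ∈ Finset.Icc (-(N : ℤ)) N, Summable fun p : ℕ × ℕ =>
      a k p.1 p.2 * qq z ^ p.1 * starRingEnd ℂ (qq z) ^ p.2) ∧
    f z = ∑ k ∈ Finset.Icc (-(N : ℤ)) N, LL z ^ k *
      ∑' p : ℕ × ℕ, a k p.1 p.2 * qq z ^ p.1 * starRingEnd ℂ (qq z) ^ p.2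

/-- The space `M_{r,s}`: real analytic functions, modular of weights `(r,s)`, with an expansion
in `ℂ[[q, q̄]][𝕃^±]`. -/
def MM (r s : ℤ) : Set (ℍ → ℂ) :=
  {f | IsRealAnalytic f ∧ IsModular r s f ∧ ∃ N a, HasExpansion f N a}

/-- The pole filtration `P^p M_{r,s}`: the coefficients of `𝕃^k` vanish for `k < p`. -/
def PM (p r s : ℤ) : Set (ℍ → ℂ) :=
  {f | f ∈ MM r s ∧ ∃ N a, HasExpansion f N a ∧ ∀ k < p, ∀ m n, a k m n = 0}

/-- The Eisenstein series `G_k = -b_k/(2k) + ∑_{n ≥ 1} σ_{k-1}(n) q^n` (for even `k ≥ 4`). -/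
def GG (k : ℕ) (z : ℍ) : ℂ :=
  -(bernoulli k : ℂ) / (2 * k) + ∑' n : ℕ+, (ArithmeticFunction.sigma (k - 1) n : ℂ) * qq z ^ (n : ℕ)

/-- The family `E r s _ = E_{r,s}`, `r + s = w`, lies in `P^{-w} M_{r,s}` and solves
`∂ E_{w,0} = 𝕃 G_{w+2}`, `∂ E_{r,s} = (r+1) E_{r+1,s-1}` for `1 ≤ s ≤ w`, and
`∂̄ E_{0,w} = 𝕃 Ḡ_{w+2}`, `∂̄ E_{r,s} = (s+1) E_{r-1,s+1}` for `1 ≤ r ≤ w`. -/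
structure IsEisensteinFamily (w : ℕ) (E : (r s : ℕ) → r + s = w → ℍ → ℂ) : Prop where
  mem : ∀ (r s : ℕ) (h : r + s = w), E r s h ∈ PM (-(w : ℤ)) r s
  partial_last : ∀ z : ℍ, partialOp w (E w 0 (by omega)) z = LL z * GG (w + 2) z
  partial_step : ∀ (r s : ℕ) (h : r + (s + 1) = w) (z : ℍ),
    partialOp r (E r (s + 1) h) z = ((r : ℂ) + 1) * E (r + 1) s (by omega) z
  partialBar_last : ∀ z : ℍ,
    partialBarOp w (E 0 w (by omega)) z = LL z * starRingEnd ℂ (GG (w + 2) z)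
  partialBar_step : ∀ (r s : ℕ) (h : (r + 1) + s = w) (z : ℍ),
    partialBarOp s (E (r + 1) s h) z = ((s : ℂ) + 1) * E r (s + 1) (by omega) z

end RealAnalyticEisenstein

end

open UpperHalfPlane

noncomputable section

namespace RealAnalyticEisenstein

/-! Existence: the lattice sums themselves solve the system. Differentiating a term brings down a
factor `m`, and `(z - z̄)m = (mz + n) - (mz̄ + n)` cancels one linear factor. Hence `∂` and `∂̄`
shift the exponents by one in opposite directions (`partialOp_eisFun`, `partialBarOp_eisFun`). At
either end one exponent is 0 and the sum is the holomorphic Eisenstein series or its conjugate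
(`latSum_zero_right`). Modularity holds because `SL₂(ℤ)` permutes the lattice.

For the expansion, the lattice is summed row by row. Partial fractions, at the cost of powers of `z
- z̄`, reduce a row to Lipschitz's formula and the cotangent series (`rowSum_expansion`). Summing
over `m` gives Lambert series in `q` and `q̄` (`latSum_expansion`).

Uniqueness: the differences `G_i` of two solutions satisfy the homogeneous system, which says
exactly that the binary form `∑ G_i (X - zY)^i (X - z̄Y)^(w-i)` does not depend on `z`. By
modularity this form is `SL₂(ℤ)`-invariant. Invariance under `T` and `S` makes it vanish at all `(n,
1)`, so it is zero and every `G_i` vanishes (`IsHomogeneousFamily.eq_zero`). -/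

/-! ### Termwise differentiation of lattice sums -/

/-- The term `1 / ((v₀u + v₁)^a (v₀ū + v₁)^b)` of a lattice sum. -/
def latTerm (a b : ℕ) (v : Fin 2 → ℤ) (u : ℂ) : ℂ :=
  ((v 0 * u + v 1) ^ a)⁻¹ * starRingEnd ℂ ((v 0 * u + v 1) ^ b)⁻¹

/-- The lattice sum `∑ 1 / ((mu + n)^a (mū + n)^b)`. -/
def latSum (a b : ℕ) (u : ℂ) : ℂ := ∑' v : Fin 2 → ℤ, latTerm a b v u

/-- The real linear map `h ↦ A h + B h̄`. -/
def wirtingerCLM (A B : ℂ) : ℂ →L[ℝ] ℂ :=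
  A • ContinuousLinearMap.id ℝ ℂ + B • (Complex.conjCLE : ℂ →L[ℝ] ℂ)

lemma wirtingerCLM_apply (A B h : ℂ) :
    wirtingerCLM A B h = A * h + B * starRingEnd ℂ h := by
  simp [wirtingerCLM]

lemma norm_wirtingerCLM_le (A B : ℂ) : ‖wirtingerCLM A B‖ ≤ ‖A‖ + ‖B‖ := by
  refine ContinuousLinearMap.opNorm_le_bound _ (by positivity) fun h => ?_
  rw [wirtingerCLM_apply, add_mul]
  refine (norm_add_le _ _).trans ?_
  simp

lemma linear_ne_zero {v : Fin 2 → ℤ} (hv : v ≠ 0) {u : ℂ} (hu : 0 < u.im) :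
    (v 0 : ℂ) * u + v 1 ≠ 0 := by
  intro h
  have h0 : v 0 = 0 := by
    have := congrArg Complex.im h
    simpa [hu.ne'] using this
  have h1 : v 1 = 0 := by
    rw [h0] at h
    simpa using h
  exact hv (by ext i; fin_cases i <;> simp [h0, h1])

lemma hasDerivAt_inv_linear_pow (a : ℕ) {m n u : ℂ} (h : m * u + n ≠ 0) :
    HasDerivAt (fun u : ℂ => ((m * u + n) ^ a)⁻¹) (-(a * m * ((m * u + n) ^ (a + 1))⁻¹)) u := by
  have h1 : HasDerivAt (fun u : ℂ => m * u + n) m u := by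
    simpa using ((hasDerivAt_id u).const_mul m).add_const n
  convert! (h1.fun_pow a).fun_inv (pow_ne_zero _ h) using 1
  rcases a with _ | a
  · simp
  · field_simp
    simp only [Nat.add_sub_cancel]
    ring

lemma hasFDerivAt_mul_conj {f g : ℂ → ℂ} {f' g' u : ℂ} (hf : HasDerivAt f f' u)
    (hg : HasDerivAt g g' u) :
    HasFDerivAt (fun u => f u * starRingEnd ℂ (g u))
      (wirtingerCLM (f' * starRingEnd ℂ (g u)) (f u * starRingEnd ℂ g')) u := by
  have h1 := hf.hasFDerivAt.restrictScalars ℝ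
  have h2 := (Complex.conjCLE : ℂ →L[ℝ] ℂ).hasFDerivAt.comp u (hg.hasFDerivAt.restrictScalars ℝ)
  convert! h1.fun_mul h2 using 1
  ext1 h
  simp [wirtingerCLM_apply]
  ring

lemma hasFDerivAt_latTerm (a b : ℕ) (v : Fin 2 → ℤ) {u : ℂ} (hu : 0 < u.im) :
    HasFDerivAt (latTerm a b v) (wirtingerCLM (-(a * v 0 * latTerm (a + 1) b v u))
      (-(b * v 0 * latTerm a (b + 1) v u))) u := by
  by_cases hv : v = 0
  · subst hv
    have : latTerm a b 0 = fun _ => latTerm a b 0 0 := by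
      ext; simp [latTerm]
    rw [this]
    refine (hasFDerivAt_const (𝕜 := ℝ) (latTerm a b 0 0) u).congr_fderiv ?_
    ext1 h
    simp [wirtingerCLM_apply]
  · have h := linear_ne_zero hv hu
    convert! hasFDerivAt_mul_conj (hasDerivAt_inv_linear_pow a h) (hasDerivAt_inv_linear_pow b h)
      using 1
    ext1 k
    simp only [wirtingerCLM_apply, latTerm]
    simp
    ring

lemma norm_latTerm (a b : ℕ) (v : Fin 2 → ℤ) (u : ℂ) :
    ‖latTerm a b v u‖ = ‖(v 0 : ℂ) * u + v 1‖ ^ (-((a + b : ℕ) : ℝ)) := by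
  rw [Real.rpow_neg (norm_nonneg _), Real.rpow_natCast]
  simp only [latTerm, norm_mul, norm_inv, norm_pow, RCLike.norm_conj]
  rw [pow_add, mul_inv]

lemma summable_latTerm {a b : ℕ} (hab : 3 ≤ a + b) {u : ℂ} (hu : 0 < u.im) :
    Summable fun v => latTerm a b v u := by
  have h2 : (2 : ℝ) < (a + b : ℕ) := by exact_mod_cast hab
  refine Summable.of_norm_bounded
    ((EisensteinSeries.summable_one_div_norm_rpow h2).mul_left
      (EisensteinSeries.r ⟨u, hu⟩ ^ (-((a + b : ℕ) : ℝ)))) fun v => ?_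
  rw [norm_latTerm]
  exact EisensteinSeries.summand_bound ⟨u, hu⟩ (by positivity) v

/-- Since `|m| Im u ≤ |mu + n|`, the factor `m` produced by differentiation is absorbed by the extra
power in the denominator. The derivatives thus have the same summable majorant as the terms. -/
lemma abs_mul_norm_latTerm_succ_le (a b c : ℕ) (v : Fin 2 → ℤ) {u : ℂ} (hu : 0 < u.im)
    (hc : 0 < a + b) {t : ℂ}
    (ht : ‖t‖ = ‖(v 0 : ℂ) * u + v 1‖ ^ (-((a + b + 1 : ℕ) : ℝ))) :
    ‖-((c : ℂ) * v 0 * t)‖ ≤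
      c / u.im * ‖(v 0 : ℂ) * u + v 1‖ ^ (-((a + b : ℕ) : ℝ)) := by
  have h1 : |(v 0 : ℝ)| * u.im ≤ ‖(v 0 : ℂ) * u + v 1‖ := by
    have := Complex.abs_im_le_norm ((v 0 : ℂ) * u + v 1)
    simpa [abs_mul, abs_of_pos hu] using this
  rw [norm_neg, norm_mul, norm_mul, ht, Real.rpow_neg (norm_nonneg _),
    Real.rpow_neg (norm_nonneg _), Real.rpow_natCast, Real.rpow_natCast]
  set N := ‖(v 0 : ℂ) * u + v 1‖
  rcases (norm_nonneg ((v 0 : ℂ) * u + v 1)).eq_or_lt with h | h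
  · have hN : N = 0 := h.symm
    rw [hN, zero_pow (by omega), zero_pow (by omega)]
    simp
  · have hN : 0 < N := h
    rw [pow_succ, mul_inv]
    simp only [Complex.norm_natCast, Complex.norm_intCast]
    have h3 : |(v 0 : ℝ)| * N⁻¹ ≤ u.im⁻¹ := by
      rw [← div_eq_mul_inv, div_le_iff₀ hN, ← div_eq_inv_mul, le_div_iff₀ hu]
      exact h1
    calc (c : ℝ) * |(v 0 : ℝ)| * ((N ^ (a + b))⁻¹ * N⁻¹)
        = c * (N ^ (a + b))⁻¹ * (|(v 0 : ℝ)| * N⁻¹) := by ring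
      _ ≤ c * (N ^ (a + b))⁻¹ * u.im⁻¹ := by gcongr
      _ = _ := by ring

lemma tsum_wirtingerCLM {ι : Type*} {A B : ι → ℂ} (h : Summable fun i => ‖A i‖ + ‖B i‖) :
    ∑' i, wirtingerCLM (A i) (B i) = wirtingerCLM (∑' i, A i) (∑' i, B i) := by
  have hA : Summable A := Summable.of_norm_bounded h fun i => by simp
  have hB : Summable B := Summable.of_norm_bounded h fun i => by simp
  simp only [wirtingerCLM]
  rw [(hA.smul_const _).tsum_add (hB.smul_const _), hA.tsum_smul_const, hB.tsum_smul_const]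

lemma hasFDerivAt_latSum {a b : ℕ} (hab : 3 ≤ a + b) {u : ℂ} (hu : 0 < u.im) :
    HasFDerivAt (latSum a b)
      (wirtingerCLM (∑' v : Fin 2 → ℤ, -(a * v 0 * latTerm (a + 1) b v u))
        (∑' v : Fin 2 → ℤ, -(b * v 0 * latTerm a (b + 1) v u))) u := by
  have h2 : (2 : ℝ) < (a + b : ℕ) := by exact_mod_cast hab
  -- The strip `|Re x| < A`, `Im x > B` is a convex open neighbourhood of `u` on which one majorant
  -- works for all points.
  set B := u.im / 2 with hB
  have hB0 : 0 < B := by positivity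
  set A := |u.re| + 1 with hA
  let bd : (Fin 2 → ℤ) → ℝ := fun v =>
    ((a + b : ℕ) : ℝ) / B * (EisensteinSeries.r ⟨⟨A, B⟩, hB0⟩ ^ (-((a + b : ℕ) : ℝ)) *
      ‖v‖ ^ (-((a + b : ℕ) : ℝ)))
  have hbd : Summable bd :=
    ((EisensteinSeries.summable_one_div_norm_rpow h2).mul_left _).mul_left _
  let s : Set ℂ := {x | |x.re| < A} ∩ {x | B < x.im}
  have hs : IsOpen s := (isOpen_lt (by fun_prop) (by fun_prop)).inter
    (isOpen_lt (by fun_prop) (by fun_prop))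
  have hconv : Convex ℝ s := by
    refine Convex.inter ?_ (convex_halfSpace_im_gt B)
    have : {x : ℂ | |x.re| < A} = {x : ℂ | x.re < A} ∩ {x : ℂ | -A < x.re} := by
      ext x; simp only [Set.mem_ofPred_eq, Set.mem_inter_iff, abs_lt]; tauto
    rw [this]
    exact (convex_halfSpace_re_lt A).inter (convex_halfSpace_re_gt (-A))
  have hus : u ∈ s := ⟨by simp [hA], by simp [hB]; linarith⟩
  have hpos : ∀ x ∈ s, 0 < x.im := fun x hx => hB0.trans hx.2
  have key : ∀ v, ∀ x ∈ s, ‖-((a : ℂ) * v 0 * latTerm (a + 1) b v x)‖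
      + ‖-((b : ℂ) * v 0 * latTerm a (b + 1) v x)‖ ≤ bd v := by
    intro v x hx
    have hx0 := hpos x hx
    have e1 := abs_mul_norm_latTerm_succ_le a b a v hx0 (by omega)
      (by rw [norm_latTerm (a + 1) b v x]; congr 3; omega)
    have e2 := abs_mul_norm_latTerm_succ_le a b b v hx0 (by omega)
      (by rw [norm_latTerm a (b + 1) v x]; congr 3)
    have e3 := EisensteinSeries.summand_bound_of_mem_verticalStrip (z := ⟨x, hx0⟩)
      (k := ((a + b : ℕ) : ℝ)) (by positivity) v hB0
      (A := A) ⟨hx.1.le, hx.2.le⟩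
    refine (add_le_add e1 e2).trans ?_
    rw [← add_mul, ← add_div, ← Nat.cast_add]
    exact mul_le_mul (by gcongr; exact hx.2.le) e3 (by positivity) (by positivity)
  have := hasFDerivAt_tsum_of_isPreconnected (𝕜 := ℝ) hbd hs hconv.isPreconnected
    (fun v x hx => hasFDerivAt_latTerm a b v (hpos x hx))
    (fun v x hx => (norm_wirtingerCLM_le _ _).trans (key v x hx)) hus
    (summable_latTerm hab hu) hus
  rw [tsum_wirtingerCLM] at this
  · exact this
  · exact Summable.of_nonneg_of_le (fun v => by positivity) (fun v => key v u hus) hbd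

lemma wirtinger_eq {f : ℍ → ℂ} {g : ℂ → ℂ} (hfg : ∀ z : ℍ, f z = g z) {A B : ℂ} {z : ℍ}
    (hg : HasFDerivAt g (wirtingerCLM A B) (z : ℂ)) :
    wirtinger f z = A ∧ wirtingerBar f z = B := by
  have hf : HasFDerivAt (fun u : ℂ => f (ofComplex u)) (wirtingerCLM A B) (z : ℂ) := by
    refine hg.congr_of_eventuallyEq ?_
    filter_upwards [(isOpen_lt continuous_const Complex.continuous_im).mem_nhds z.2] with u hu
    rw [hfg, ofComplex_apply_of_im_pos hu]
  have hI := Complex.I_mul_I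
  rw [wirtinger, wirtingerBar, hf.fderiv, wirtingerCLM_apply, wirtingerCLM_apply, map_one,
    Complex.conj_I]
  constructor
  · linear_combination (-A / 2 + B / 2) * hI
  · linear_combination (A / 2 - B / 2) * hI

/-! ### The differential equations -/

/-- The function `c 𝕃 ∑ 1 / ((mz + n)^a (mz̄ + n)^b)`. -/
def eisFun (c : ℂ) (a b : ℕ) (z : ℍ) : ℂ := c * LL z * latSum a b z

/-- With `x = mu + n` and `y = mū + n`, one has `(u - ū)m = x - y`, so each derivative term splits
into two terms of the original shape. This identity is the source of the ladder of equations. -/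
lemma mul_tsum_deriv_latTerm {a b : ℕ} (hab : 3 ≤ a + (b + 1)) {u : ℂ} (hu : 0 < u.im) :
    (u - starRingEnd ℂ u) * ∑' v : Fin 2 → ℤ, -(a * v 0 * latTerm (a + 1) (b + 1) v u) =
      a * (latSum (a + 1) b u - latSum a (b + 1) u) := by
  rw [latSum, latSum, ← (summable_latTerm (by omega) hu).tsum_sub (summable_latTerm hab hu),
    ← tsum_mul_left, ← tsum_mul_left]
  refine tsum_congr fun v => ?_
  by_cases hv : v = 0
  · subst hv
    simp [latTerm]
  have h := linear_ne_zero hv hu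
  have h' : (v 0 : ℂ) * starRingEnd ℂ u + v 1 ≠ 0 := by
    have := (map_ne_zero (starRingEnd ℂ)).mpr h
    simpa using this
  simp only [latTerm, map_inv₀, map_pow, map_add, map_mul, map_intCast]
  have e : (u - starRingEnd ℂ u) * v 0 = (v 0 * u + v 1) - (v 0 * starRingEnd ℂ u + v 1) := by
    ring
  rw [show ∀ t : ℂ, (u - starRingEnd ℂ u) * -(a * v 0 * t) =
    -(a * ((u - starRingEnd ℂ u) * v 0) * t) from fun t => by ring, e]
  generalize (v 0 : ℂ) * u + v 1 = x at *
  generalize (v 0 : ℂ) * starRingEnd ℂ u + v 1 = y at *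
  field_simp
  ring

lemma latTerm_conj (a b : ℕ) (v : Fin 2 → ℤ) (u : ℂ) :
    latTerm b a v u = starRingEnd ℂ (latTerm a b v u) := by
  simp [latTerm, mul_comm]

lemma latSum_conj (a b : ℕ) (u : ℂ) : latSum b a u = starRingEnd ℂ (latSum a b u) := by
  rw [latSum, latSum, Complex.conj_tsum]
  exact tsum_congr fun v => latTerm_conj a b v u

lemma mul_tsum_deriv_latTerm_bar {a b : ℕ} (hab : 3 ≤ (a + 1) + b) {u : ℂ} (hu : 0 < u.im) :
    (starRingEnd ℂ u - u) * ∑' v : Fin 2 → ℤ, -(b * v 0 * latTerm (a + 1) (b + 1) v u) =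
      b * (latSum a (b + 1) u - latSum (a + 1) b u) := by
  have := congrArg (starRingEnd ℂ) (mul_tsum_deriv_latTerm (a := b) (b := a) (by omega) hu)
  simpa [Complex.conj_tsum, ← latTerm_conj, ← latSum_conj] using this

lemma hasFDerivAt_eisFun (c : ℂ) {a b : ℕ} (hab : 3 ≤ a + b) {u : ℂ} (hu : 0 < u.im) :
    HasFDerivAt (fun u : ℂ => c * (Complex.I * Real.pi * (u - starRingEnd ℂ u)) * latSum a b u)
      (wirtingerCLM
        (c * (Complex.I * Real.pi) * latSum a b u + c * (Complex.I * Real.pi) *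
          ((u - starRingEnd ℂ u) * ∑' v : Fin 2 → ℤ, -(a * v 0 * latTerm (a + 1) b v u)))
        (-(c * (Complex.I * Real.pi) * latSum a b u) - c * (Complex.I * Real.pi) *
          ((starRingEnd ℂ u - u) * ∑' v : Fin 2 → ℤ, -(b * v 0 * latTerm a (b + 1) v u)))) u := by
  have h0 : HasFDerivAt (fun u : ℂ => c * (Complex.I * Real.pi * (u - starRingEnd ℂ u)))
      (wirtingerCLM (c * (Complex.I * Real.pi)) (-(c * (Complex.I * Real.pi)))) u := by
    have : (fun u : ℂ => c * (Complex.I * Real.pi * (u - starRingEnd ℂ u))) =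
        wirtingerCLM (c * (Complex.I * Real.pi)) (-(c * (Complex.I * Real.pi))) := by
      ext h
      rw [wirtingerCLM_apply]
      ring
    rw [this]
    exact ContinuousLinearMap.hasFDerivAt _
  refine (h0.fun_mul (hasFDerivAt_latSum hab hu)).congr_fderiv ?_
  ext1 h
  simp only [wirtingerCLM_apply, add_apply, smul_apply,
    smul_eq_mul]
  ring

/-- The derivative of `𝕃` contributes one copy of the function and the weight contributes `r`
copies; together they cancel the `-(r + 1)` copies from `mul_tsum_deriv_latTerm`. This is why the
exponent is `r + 1`. -/
lemma partialOp_eisFun (c : ℂ) (r b : ℕ) (hab : 2 ≤ r + 1 + b) (z : ℍ) :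
    partialOp r (eisFun c (r + 1) (b + 1)) z = (r + 1) * eisFun c (r + 2) b z := by
  have h := (wirtinger_eq (f := eisFun c (r + 1) (b + 1)) (fun z => rfl)
    (hasFDerivAt_eisFun c (by omega) z.2)).1
  rw [partialOp, h, mul_tsum_deriv_latTerm (by omega) z.2]
  simp only [eisFun, LL]
  push_cast
  ring

lemma partialBarOp_eisFun (c : ℂ) (a s : ℕ) (hab : 2 ≤ a + (s + 1)) (z : ℍ) :
    partialBarOp s (eisFun c (a + 1) (s + 1)) z = (s + 1) * eisFun c a (s + 2) z := by
  have h := (wirtinger_eq (f := eisFun c (a + 1) (s + 1)) (fun z => rfl)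
    (hasFDerivAt_eisFun c (by omega) z.2)).2
  rw [partialBarOp, h, mul_tsum_deriv_latTerm_bar (by omega) z.2]
  simp only [eisFun, LL]
  push_cast
  ring

/-! ### Modularity -/

lemma latTerm_eq_eisSummand (a b : ℕ) (v : Fin 2 → ℤ) (z : ℍ) :
    latTerm a b v z = EisensteinSeries.eisSummand a v z *
      starRingEnd ℂ (EisensteinSeries.eisSummand b v z) := by
  simp [latTerm, EisensteinSeries.eisSummand]

/-- Right multiplication by `γ` permutes the integral row vectors. -/
def vecMulEquiv (γ : Matrix.SpecialLinearGroup (Fin 2) ℤ) : (Fin 2 → ℤ) ≃ (Fin 2 → ℤ) where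
  toFun v := Matrix.vecMul v (γ : Matrix (Fin 2) (Fin 2) ℤ)
  invFun v := Matrix.vecMul v ((γ⁻¹ : Matrix.SpecialLinearGroup (Fin 2) ℤ) :
    Matrix (Fin 2) (Fin 2) ℤ)
  left_inv v := by
    simp only
    rw [Matrix.vecMul_vecMul, ← Matrix.SpecialLinearGroup.coe_mul, mul_inv_cancel,
      Matrix.SpecialLinearGroup.coe_one, Matrix.vecMul_one]
  right_inv v := by
    simp only
    rw [Matrix.vecMul_vecMul, ← Matrix.SpecialLinearGroup.coe_mul, inv_mul_cancel,
      Matrix.SpecialLinearGroup.coe_one, Matrix.vecMul_one]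

/-- Each summand at `γz` is the automorphy factor times the summand at `z` indexed by `vγ`, and `v ↦
vγ` is a bijection of the lattice. -/
lemma latSum_smul (a b : ℕ) (γ : Matrix.SpecialLinearGroup (Fin 2) ℤ) (z : ℍ) :
    latSum a b ((γ • z : ℍ) : ℂ) = denom γ z ^ a * starRingEnd ℂ (denom γ z) ^ b *
      latSum a b z := by
  rw [latSum, latSum, ← (vecMulEquiv γ).tsum_eq (fun v => latTerm a b v z), ← tsum_mul_left]
  refine tsum_congr fun v => ?_
  rw [latTerm_eq_eisSummand, latTerm_eq_eisSummand, EisensteinSeries.eisSummand_SL2_apply,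
    EisensteinSeries.eisSummand_SL2_apply]
  simp only [vecMulEquiv, Equiv.coe_fn_mk, map_mul, zpow_natCast, map_pow]
  ring

lemma LL_eq (z : ℍ) : LL z = -(2 * Real.pi * z.im : ℝ) := by
  rw [LL, Complex.sub_conj]
  have hI := Complex.I_mul_I
  push_cast
  rw [UpperHalfPlane.coe_im]
  linear_combination (2 * Real.pi * z.im : ℂ) * hI

lemma LL_ne_zero (z : ℍ) : LL z ≠ 0 := by
  rw [LL_eq, neg_ne_zero, Complex.ofReal_ne_zero]
  have := z.im_pos
  positivity

lemma LL_smul (γ : Matrix.SpecialLinearGroup (Fin 2) ℤ) (z : ℍ) :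
    denom γ z * starRingEnd ℂ (denom γ z) * LL (γ • z) = LL z := by
  rw [LL_eq, LL_eq, Complex.mul_conj, ModularGroup.im_smul_eq_div_normSq]
  have : Complex.normSq (denom γ z) ≠ 0 := by simp [denom_ne_zero]
  push_cast
  have h' : (Complex.normSq (denom γ z) : ℂ) ≠ 0 := by exact_mod_cast this
  field_simp

lemma isModular_eisFun (c : ℂ) (r s : ℕ) : IsModular r s (eisFun c (r + 1) (s + 1)) := by
  intro γ z
  have hd : denom γ z = (γ 1 0 : ℂ) * z + γ 1 1 := by
    simp [ModularGroup.denom_apply]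
  have hd' : starRingEnd ℂ (denom γ z) = (γ 1 0 : ℂ) * starRingEnd ℂ (z : ℂ) + γ 1 1 := by
    simp [hd]
  rw [← hd', ← hd, eisFun, eisFun, latSum_smul, ← LL_smul γ z, zpow_natCast, zpow_natCast]
  ring

/-- This is the classical `q`-expansion of the holomorphic Eisenstein series; Euler's formula for
`ζ(w + 2)` turns its constant term into the Bernoulli number. -/
lemma latSum_zero_right {w : ℕ} (hw : 1 ≤ w) (hw2 : Even w) (z : ℍ) :
    ((w + 1).factorial : ℂ) / (2 * Real.pi * Complex.I) ^ (w + 2) * (1 / 2) *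
      latSum (w + 2) 0 z = GG (w + 2) z := by
  have h := tsum_eisSummand_eq_tsum_sigma_mul_cexp_pow (k := w + 2) (by omega)
    (hw2.add even_two) z
  have h1 : latSum (w + 2) 0 z = ∑' v, EisensteinSeries.eisSummand (w + 2 : ℕ) v z := by
    refine tsum_congr fun v => ?_
    rw [latTerm_eq_eisSummand]
    simp [EisensteinSeries.eisSummand]
  obtain ⟨k, rfl⟩ := hw2
  have hz := riemannZeta_two_mul_nat (k := k + 1) (by omega)
  have e2 : k + k + 2 = 2 * (k + 1) := by ring
  have hf : ((2 * (k + 1)).factorial : ℂ) = 2 * (k + 1) * (k + k + 1).factorial := by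
    rw [← e2, Nat.factorial_succ]
    push_cast
    ring
  have hf0 : ((k + k + 1).factorial : ℂ) ≠ 0 := by exact_mod_cast Nat.factorial_ne_zero _
  have hpi : (Real.pi : ℂ) ≠ 0 := by exact_mod_cast Real.pi_ne_zero
  have hk0 : (k : ℂ) + 1 ≠ 0 := by exact_mod_cast Nat.succ_ne_zero k
  have hP : (2 * Real.pi * Complex.I) ^ (k + k + 2) =
      (-1) ^ (k + 1) * (2 : ℂ) ^ (2 * (k + 1)) * (Real.pi : ℂ) ^ (2 * (k + 1)) := by
    rw [e2, mul_pow, mul_pow, pow_mul Complex.I, Complex.I_sq]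
    ring
  have hsgn : (-1 : ℂ) ^ (k + 1) ≠ 0 := pow_ne_zero _ (by norm_num)
  have hN : (-2 * Real.pi * Complex.I) ^ (k + k + 2) =
      (2 * Real.pi * Complex.I) ^ (k + k + 2) := by
    rw [e2, pow_mul, pow_mul]
    congr 1
    ring
  have h2 : (2 : ℂ) ^ (2 * (k + 1)) = 2 * 2 ^ (2 * (k + 1) - 1) := by
    rw [← pow_succ']
    rfl
  rw [h1, h, GG, hN, show k + k + 2 - 1 = k + k + 1 by omega]
  have hcast : ((k + k + 2 : ℕ) : ℂ) = 2 * ((k + 1 : ℕ) : ℂ) := by push_cast; ring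
  rw [hcast, hz, mul_add, hP]
  congr 1
  · rw [e2, hf, h2]
    push_cast
    field_simp
    ring
  · simp only [qq]
    field_simp

/-! ### Expansion of one row of the lattice -/

/-- The sum `∑ 1 / ((u + n)^a (ū + n)^b)` over a row of the lattice. -/
def rowSum (a b : ℕ) (u : ℂ) : ℂ := ∑' n : ℤ, latTerm a b ![1, n] u

/-- The series `∑_{d ≥ 1} d^j q^d`. -/
def powSeries (j : ℕ) (q : ℂ) : ℂ := ∑' d : ℕ+, (d : ℂ) ^ j * q ^ (d : ℕ)

lemma summable_row {a b : ℕ} (hab : 2 ≤ a + b) (u : ℂ) :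
    Summable fun n : ℤ => latTerm a b ![1, n] u := by
  have h := (EisensteinSeries.linear_right_summable u 1 (k := (a + b : ℕ))
    (by exact_mod_cast hab)).norm
  refine Summable.of_norm (h.congr fun n => ?_)
  rw [norm_latTerm, Real.rpow_neg (norm_nonneg _), Real.rpow_natCast, zpow_natCast]
  simp

lemma latTerm_smul (a b : ℕ) (m n : ℤ) (u : ℂ) :
    latTerm a b ![m, n] u = latTerm a b ![1, n] (m * u) := by
  simp [latTerm]

lemma row_ne_zero {u : ℂ} (hu : 0 < u.im) (n : ℤ) : u + n ≠ 0 := by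
  intro h
  have := congrArg Complex.im h
  simp at this
  exact hu.ne' this

/-- Partial fractions: `u - ū = (u + n) - (ū + n)` trades one factor `u - ū` for lowering the total
exponent by one. -/
lemma mul_rowSum {a b : ℕ} (hab : 1 ≤ a + b) {u : ℂ} (hu : 0 < u.im) :
    (u - starRingEnd ℂ u) * rowSum (a + 1) (b + 1) u =
      rowSum a (b + 1) u - rowSum (a + 1) b u := by
  rw [rowSum, rowSum, rowSum, ← (summable_row (by omega) u).tsum_sub (summable_row (by omega) u),
    ← tsum_mul_left]
  refine tsum_congr fun n => ?_
  have h := row_ne_zero hu n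
  have h' : starRingEnd ℂ u + n ≠ 0 := by
    have := (map_ne_zero (starRingEnd ℂ)).mpr h
    simpa using this
  have e : u - starRingEnd ℂ u = (u + n) - (starRingEnd ℂ u + n) := by ring
  rw [e]
  simp only [latTerm, map_inv₀, map_pow, map_add, map_intCast, Matrix.cons_val_zero,
    Matrix.cons_val_one, Int.cast_one, one_mul]
  generalize u + (n : ℂ) = x at *
  generalize starRingEnd ℂ u + (n : ℂ) = y at *
  field_simp
  ring

lemma rowSum_conj (a b : ℕ) (u : ℂ) : rowSum b a u = starRingEnd ℂ (rowSum a b u) := by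
  rw [rowSum, rowSum, Complex.conj_tsum]
  exact tsum_congr fun v => latTerm_conj a b _ u

lemma powSeries_conj (j : ℕ) (q : ℂ) :
    powSeries j (starRingEnd ℂ q) = starRingEnd ℂ (powSeries j q) := by
  rw [powSeries, powSeries, Complex.conj_tsum]
  simp

/-- Lipschitz's formula, one of the base cases of the partial fraction recursion. -/
lemma rowSum_zero_right (k : ℕ) (z : ℍ) :
    rowSum (k + 2) 0 z =
      (-2 * Real.pi * Complex.I) ^ (k + 2) / (k + 1).factorial * powSeries (k + 1) (qq z) := by
  rw [powSeries, qq, ← EisensteinSeries.qExpansion_identity_pnat (by omega) z, rowSum]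
  simp [latTerm]

lemma norm_qq_lt_one (z : ℍ) : ‖qq z‖ < 1 := UpperHalfPlane.norm_exp_two_pi_I_lt_one z

lemma pi_mul_cot (z : ℍ) : Real.pi * Complex.cot (Real.pi * z) =
    -(Real.pi * Complex.I) - 2 * Real.pi * Complex.I * powSeries 0 (qq z) := by
  have hs : Summable fun n : ℕ => qq z ^ n :=
    summable_geometric_of_norm_lt_one (norm_qq_lt_one z)
  have h := tsum_zero_pnat_eq_tsum_nat hs
  rw [pi_mul_cot_pi_q_exp, powSeries]
  simp only [qq] at h ⊢
  rw [← h]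
  simp
  ring

/-- The base case that `mul_rowSum` cannot reach, since `∑ 1 / (u + n)` is not absolutely
convergent. The difference of the series at `ū` and `u` does converge absolutely, and is the
difference of two cotangents. -/
lemma mul_rowSum_one_one (z : ℍ) :
    ((z : ℂ) - starRingEnd ℂ (z : ℂ)) * rowSum 1 1 z =
      2 * Real.pi * Complex.I * (1 + powSeries 0 (qq z) + powSeries 0 (starRingEnd ℂ (qq z))) := by
  set u : ℂ := (z : ℂ) with hu
  let g : ℤ → ℂ := fun n => (starRingEnd ℂ u + n)⁻¹ - (u + n)⁻¹
  have hterm : ∀ n : ℤ, (u - starRingEnd ℂ u) * latTerm 1 1 ![1, n] u = g n := by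
    intro n
    have h := row_ne_zero z.2 n
    have h' : starRingEnd ℂ u + n ≠ 0 := by
      have := (map_ne_zero (starRingEnd ℂ)).mpr h
      simpa using this
    have h'' : u + n ≠ 0 := h
    simp [latTerm, g]
    field_simp
    ring
  have hg : Summable g := ((summable_row (by norm_num) u).mul_left _).congr hterm
  have hmem : u ∈ Complex.integerComplement := UpperHalfPlane.coe_mem_integerComplement z
  have hcot := cot_series_rep' hmem
  have hsum := summable_cotTerm hmem
  have hsum' : Summable fun n : ℕ => 1 / (u - (n + 1)) + 1 / (u + (n + 1)) := hsum
  have hconj : ∑' n : ℕ, starRingEnd ℂ (1 / (u - (n + 1)) + 1 / (u + (n + 1))) =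
      starRingEnd ℂ (Real.pi * Complex.cot (Real.pi * u) - 1 / u) := by
    rw [hcot, Complex.conj_tsum]
  have hsumc : Summable fun n : ℕ => starRingEnd ℂ (1 / (u - (n + 1)) + 1 / (u + (n + 1))) :=
    Complex.conjCLE.summable.mpr hsum'
  have key : ∑' n : ℤ, g n = starRingEnd ℂ (Real.pi * Complex.cot (Real.pi * u)) -
      Real.pi * Complex.cot (Real.pi * u) := by
    -- Pairing `n` with `-n` gives the symmetric summation of the cotangent series; this counts `n =
    -- 0` twice, which is corrected when that term is removed.
    have h1 := hg.hasSum.nat_add_neg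
    have h2 := (hasSum_nat_add_iff' 1).mpr h1
    have h3 := h2.tsum_eq
    have h4 : ∑' n : ℕ, (g ((n + 1 : ℕ) : ℤ) + g (-((n + 1 : ℕ) : ℤ))) =
        starRingEnd ℂ (Real.pi * Complex.cot (Real.pi * u) - 1 / u) -
          (Real.pi * Complex.cot (Real.pi * u) - 1 / u) := by
      rw [← hconj, hcot, ← hsumc.tsum_sub hsum']
      refine tsum_congr fun n => ?_
      simp [g, sub_eq_add_neg]
      ring
    rw [h4] at h3
    simp [g] at h3 ⊢
    linear_combination -h3
  rw [rowSum, ← tsum_mul_left, tsum_congr hterm, key, pi_mul_cot, powSeries_conj]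
  simp [map_ofNat]
  ring

/-- The expansion of the row sums of the lattice. -/
theorem rowSum_expansion (K : ℕ) : ∀ a b : ℕ, 2 ≤ a + b → a + b ≤ K →
    ∃ (c₀ : ℂ) (c c' : ℕ → ℂ), ∀ z : ℍ,
      ((z : ℂ) - starRingEnd ℂ (z : ℂ)) ^ (a + b - 1) * rowSum a b z =
        c₀ + ∑ j ∈ Finset.range K, ((z : ℂ) - starRingEnd ℂ (z : ℂ)) ^ j *
          (c j * powSeries j (qq z) + c' j * powSeries j (starRingEnd ℂ (qq z)))
  | 0, 0, h, _ => by omega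
  | 0, 1, h, _ => by omega
  | 1, 0, h, _ => by omega
  | a + 2, 0, _, hK => by
    refine ⟨0, Pi.single (a + 1) ((-2 * Real.pi * Complex.I) ^ (a + 2) / (a + 1).factorial), 0,
      fun z => ?_⟩
    rw [rowSum_zero_right, Finset.sum_eq_single (a + 1)]
    · simp
    · intro j _ hj
      simp [hj]
    · intro h
      simp at h
      omega
  | 0, b + 2, _, hK => by
    refine ⟨0, 0, Pi.single (b + 1) (starRingEnd ℂ ((-2 * Real.pi * Complex.I) ^ (b + 2) /
      (b + 1).factorial)), fun z => ?_⟩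
    rw [rowSum_conj, rowSum_zero_right, Finset.sum_eq_single (b + 1), powSeries_conj]
    · simp
    · intro j _ hj
      simp [hj]
    · intro h
      simp at h
      omega
  | a + 1, b + 1, h, hK => by
    by_cases hab : a + b = 0
    · obtain ⟨rfl, rfl⟩ : a = 0 ∧ b = 0 := by omega
      refine ⟨2 * Real.pi * Complex.I, Pi.single 0 (2 * Real.pi * Complex.I),
        Pi.single 0 (2 * Real.pi * Complex.I), fun z => ?_⟩
      rw [Finset.sum_eq_single 0]
      · simp only [Nat.reduceAdd, Nat.add_one_sub_one, pow_one]
        rw [mul_rowSum_one_one]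
        simp
        ring
      · intro j _ hj
        simp [hj]
      · intro h
        simp at h
        omega
    -- Both calls keep the same `K`, so the two sums have the same range and subtract termwise.
    obtain ⟨c₀, c, c', h1⟩ := rowSum_expansion K a (b + 1) (by omega) (by omega)
    obtain ⟨d₀, d, d', h2⟩ := rowSum_expansion K (a + 1) b (by omega) (by omega)
    refine ⟨c₀ - d₀, c - d, c' - d', fun z => ?_⟩
    have e : a + 1 + (b + 1) - 1 = (a + b) + 1 := by omega
    have h1' := h1 z
    have h2' := h2 z
    rw [show a + (b + 1) - 1 = a + b by omega] at h1'
    rw [show a + 1 + b - 1 = a + b by omega] at h2'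
    rw [e, pow_succ, mul_assoc, mul_rowSum (by omega) z.2, mul_sub, h1', h2']
    rw [add_sub_add_comm, ← Finset.sum_sub_distrib]
    congr 1
    refine Finset.sum_congr rfl fun j _ => ?_
    simp only [Pi.sub_apply]
    ring
termination_by a b => a + b

/-! ### Lambert series and the sum over rows -/

/-- The coefficient `m^j d^j / m^n` of a Lambert series. -/
def lambertCoeff (j n : ℕ) (p : ℕ+ × ℕ+) : ℂ := (p.1 : ℂ) ^ j * ((p.1 : ℂ) ^ n)⁻¹ * (p.2 : ℂ) ^ j

/-- The Lambert series `∑ m^(j-n) d^j x^(md)`. -/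
def lambert (j n : ℕ) (x : ℂ) : ℂ :=
  ∑' p : ℕ+ × ℕ+, lambertCoeff j n p * x ^ ((p.1 : ℕ) * p.2)

lemma summable_pnat_pow_mul_geometric (j : ℕ) {ρ : ℝ} (h0 : 0 ≤ ρ) (h1 : ρ < 1) :
    Summable fun m : ℕ+ => (m : ℝ) ^ j * ρ ^ (m : ℕ) :=
  (summable_pow_mul_geometric_of_norm_lt_one j (r := ρ)
    (by rwa [Real.norm_of_nonneg h0])).comp_injective PNat.coe_injective

lemma summable_lambert (j n : ℕ) {x : ℂ} (hx : ‖x‖ < 1) :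
    Summable fun p : ℕ+ × ℕ+ => lambertCoeff j n p * x ^ ((p.1 : ℕ) * p.2) := by
  -- For `m, d ≥ 1` one has `2md ≥ m + d`, so `|x|^(md) ≤ ρ^m ρ^d` and the double series is
  -- dominated by a product of two single ones.
  set ρ := Real.sqrt ‖x‖ with hρ
  have h0 : 0 ≤ ρ := Real.sqrt_nonneg _
  have h1 : ρ < 1 := by rw [hρ, Real.sqrt_lt' one_pos]; simpa using hx
  have hxρ : ‖x‖ = ρ ^ 2 := (Real.sq_sqrt (norm_nonneg x)).symm
  have hs := summable_pnat_pow_mul_geometric j h0 h1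
  refine Summable.of_norm_bounded
    (hs.mul_of_nonneg hs (fun _ => by positivity) (fun _ => by positivity)) fun p => ?_
  obtain ⟨m, d⟩ := p
  have hm : (1 : ℝ) ≤ (m : ℝ) := by exact_mod_cast m.pos
  have hmn : ((m : ℝ) ^ n)⁻¹ ≤ 1 := inv_le_one_of_one_le₀ (one_le_pow₀ hm)
  have hpow : (ρ ^ 2) ^ ((m : ℕ) * d) ≤ ρ ^ ((m : ℕ) + d) := by
    rw [← pow_mul]
    refine pow_le_pow_of_le_one h0 h1.le ?_
    have h3 : (1 : ℕ) ≤ m := m.pos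
    have h4 : (1 : ℕ) ≤ d := d.pos
    nlinarith
  simp only [lambertCoeff, norm_mul, norm_pow, norm_inv, Complex.norm_natCast, hxρ]
  calc (m : ℝ) ^ j * ((m : ℝ) ^ n)⁻¹ * (d : ℝ) ^ j * (ρ ^ 2) ^ ((m : ℕ) * d)
      ≤ (m : ℝ) ^ j * 1 * (d : ℝ) ^ j * ρ ^ ((m : ℕ) + d) := by gcongr
    _ = _ := by rw [pow_add]; ring

lemma hasSum_lambert (j n : ℕ) {x : ℂ} (hx : ‖x‖ < 1) :
    HasSum (fun m : ℕ+ => (m : ℂ) ^ j * ((m : ℂ) ^ n)⁻¹ * powSeries j (x ^ (m : ℕ)))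
      (lambert j n x) := by
  have hs := summable_lambert j n hx
  rw [lambert, hs.tsum_prod]
  convert! hs.prod.hasSum using 2 with m
  rw [powSeries, ← tsum_mul_left]
  refine tsum_congr fun d => ?_
  rw [lambertCoeff, pow_mul]
  ring

lemma lambert_conj (j n : ℕ) (x : ℂ) :
    lambert j n (starRingEnd ℂ x) = starRingEnd ℂ (lambert j n x) := by
  rw [lambert, lambert, Complex.conj_tsum]
  simp [lambertCoeff]

/-- `Q` is a power series in `q` that converges on the upper half plane. -/
def IsQSeries (Q : ℍ → ℂ) : Prop :=
  ∃ α : ℕ → ℂ, ∀ z : ℍ, HasSum (fun n => α n * qq z ^ n) (Q z)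

lemma IsQSeries.const_mul {Q : ℍ → ℂ} (hQ : IsQSeries Q) (c : ℂ) :
    IsQSeries fun z => c * Q z := by
  obtain ⟨α, h⟩ := hQ
  exact ⟨fun n => c * α n, fun z => by simpa only [mul_assoc] using (h z).mul_left c⟩

lemma isQSeries_const (c : ℂ) : IsQSeries fun _ => c := by
  refine ⟨Pi.single 0 c, fun z => ?_⟩
  convert! hasSum_single (f := fun n => (Pi.single 0 c : ℕ → ℂ) n * qq z ^ n) 0 ?_ using 1
  · simp
  · intro n hn
    simp [hn]

/-- Group the pairs `(m, d)` by the product `N = md`. -/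
lemma isQSeries_lambert (j n : ℕ) : IsQSeries fun z => lambert j n (qq z) := by
  refine ⟨fun N => ∑' p : (fun p : ℕ+ × ℕ+ => (p.1 : ℕ) * p.2) ⁻¹' {N}, lambertCoeff j n p,
    fun z => ?_⟩
  convert! (summable_lambert j n (norm_qq_lt_one z)).hasSum.tsum_fiberwise
    (fun p : ℕ+ × ℕ+ => (p.1 : ℕ) * p.2) using 2 with N
  rw [← tsum_mul_right]
  refine tsum_congr fun p => ?_
  have hp : (p.1.1 : ℕ) * p.1.2 = N := p.2
  rw [hp]

/-- Rows `m` and `-m` agree because `a + b` is even, and row `m` at `u` is row 1 at `mu`. Row 0 does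
not depend on `u`, hence its evaluation at `0`. -/
lemma latSum_eq_tsum_rowSum {a b : ℕ} (hab : 3 ≤ a + b) (heven : Even (a + b)) {u : ℂ}
    (hu : 0 < u.im) :
    HasSum (fun m : ℕ+ => 2 * rowSum a b (m * u))
      (latSum a b u - ∑' n : ℤ, latTerm a b ![0, n] 0) := by
  have hs : Summable fun p : ℤ × ℤ => latTerm a b ![p.1, p.2] u :=
    (finTwoArrowEquiv ℤ).symm.summable_iff.mpr (summable_latTerm hab hu)
  have h1 : latSum a b u = ∑' m : ℤ, ∑' n : ℤ, latTerm a b ![m, n] u := by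
    rw [latSum, ← (finTwoArrowEquiv ℤ).symm.tsum_eq, ← hs.tsum_prod]
    rfl
  have hev : Function.Even fun m : ℤ => ∑' n : ℤ, latTerm a b ![m, n] u := by
    intro m
    simp only
    rw [← tsum_comp_neg]
    refine tsum_congr fun n => ?_
    have : (-1 : ℂ) ^ a * (-1) ^ b = 1 := by rw [← pow_add, heven.neg_one_pow]
    have e : (((-m : ℤ) : ℂ) * u + ((-n : ℤ) : ℂ)) = -1 * ((m : ℂ) * u + n) := by push_cast; ring
    have hone : ((-1 : ℂ) ^ a)⁻¹ * ((-1 : ℂ) ^ b)⁻¹ = 1 := by rw [← mul_inv, this, inv_one]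
    simp only [latTerm, Matrix.cons_val_zero, Matrix.cons_val_one]
    rw [e]
    simp only [mul_pow, mul_inv, map_mul, map_inv₀, map_pow, map_neg, map_one]
    linear_combination (((m : ℂ) * u + n) ^ a)⁻¹ *
      ((starRingEnd ℂ ((m : ℂ) * u + n)) ^ b)⁻¹ * hone
  have h2 := tsum_int_eq_zero_add_two_mul_tsum_pnat hev hs.prod
  have h3 : Summable fun m : ℕ+ => rowSum a b (m * u) := by
    have := hs.prod.comp_injective (i := fun m : ℕ+ => ((m : ℕ) : ℤ))
      (fun x y h => by simpa using h)
    refine this.congr fun m => ?_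
    rw [rowSum]
    refine tsum_congr fun n => ?_
    rw [latTerm_smul]
    simp
  have h4 : latSum a b u - ∑' n : ℤ, latTerm a b ![0, n] 0 =
      2 * ∑' m : ℕ+, rowSum a b (m * u) := by
    rw [h1, h2]
    have e1 : ∀ n : ℤ, latTerm a b ![0, n] u = latTerm a b ![0, n] 0 := fun n => by simp [latTerm]
    have e2 : ∀ m : ℕ+, ∑' n : ℤ, latTerm a b ![((m : ℕ) : ℤ), n] u = rowSum a b (m * u) := by
      intro m
      rw [rowSum]
      refine tsum_congr fun n => ?_
      rw [latTerm_smul]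
      simp
    simp only [e1, e2]
    rw [nsmul_eq_mul]
    push_cast
    ring
  rw [h4]
  exact h3.hasSum.mul_left 2

/-- The expansion of the lattice sums in Lambert series. -/
theorem latSum_expansion {a b : ℕ} (hab : 3 ≤ a + b) (heven : Even (a + b)) :
    ∃ (κ c₀ : ℂ) (c c' : ℕ → ℂ), ∀ z : ℍ,
      ((z : ℂ) - starRingEnd ℂ (z : ℂ)) ^ (a + b - 1) * latSum a b z =
        κ * ((z : ℂ) - starRingEnd ℂ (z : ℂ)) ^ (a + b - 1) + c₀ +
          ∑ j ∈ Finset.range (a + b), ((z : ℂ) - starRingEnd ℂ (z : ℂ)) ^ j *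
            (c j * lambert j (a + b - 1) (qq z) +
              c' j * starRingEnd ℂ (lambert j (a + b - 1) (qq z))) := by
  obtain ⟨c₀, c, c', h⟩ := rowSum_expansion (a + b) a b (by omega) le_rfl
  set n := a + b - 1 with hn
  have hZ : Summable fun m : ℕ+ => ((m : ℂ) ^ n)⁻¹ := by
    have : Summable fun m : ℕ => ((m : ℂ) ^ n)⁻¹ := by
      refine Summable.of_norm ?_
      simpa using Real.summable_nat_pow_inv (p := n) |>.mpr (by omega)
    exact this.comp_injective PNat.coe_injective
  -- `κ` is row 0; summing the constant term of each row, weighted by `m^(-n)`, gives the zeta value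
  -- multiplying `c₀`.
  refine ⟨∑' n : ℤ, latTerm a b ![0, n] 0, 2 * (c₀ * ∑' m : ℕ+, ((m : ℂ) ^ n)⁻¹),
    fun j => 2 * c j, fun j => 2 * c' j, fun z => ?_⟩
  set D := (z : ℂ) - starRingEnd ℂ (z : ℂ) with hD
  have h1 := (latSum_eq_tsum_rowSum hab heven z.2).mul_left (D ^ n)
  -- Apply the row expansion at `mz`, where `z - z̄` becomes `mD` and `q` becomes `q^m`, then divide
  -- by `m^n`.
  have hrow : ∀ m : ℕ+, D ^ n * (2 * rowSum a b (m * z)) =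
      2 * (c₀ * ((m : ℂ) ^ n)⁻¹ + ∑ j ∈ Finset.range (a + b), D ^ j *
        (c j * ((m : ℂ) ^ j * ((m : ℂ) ^ n)⁻¹ * powSeries j (qq z ^ (m : ℕ))) +
          c' j * ((m : ℂ) ^ j * ((m : ℂ) ^ n)⁻¹ *
            powSeries j (starRingEnd ℂ (qq z) ^ (m : ℕ))))) := by
    intro m
    have hm0 : (m : ℂ) ≠ 0 := by exact_mod_cast m.ne_zero
    have him : 0 < ((m : ℂ) * (z : ℂ)).im := by
      have : (0 : ℝ) < m := by exact_mod_cast m.pos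
      simpa using mul_pos this z.2
    have h2 := h ⟨(m : ℂ) * z, him⟩
    have hq : qq ⟨(m : ℂ) * z, him⟩ = qq z ^ (m : ℕ) := by
      simp only [qq]
      rw [← Complex.exp_nat_mul]
      congr 1
      ring
    have hD' : (m : ℂ) * z - starRingEnd ℂ ((m : ℂ) * z) = m * D := by
      simp [hD]
      ring
    simp only [hq, hD', map_pow] at h2
    rw [mul_pow] at h2
    have h3 : D ^ n * rowSum a b (m * z) = ((m : ℂ) ^ n)⁻¹ *
        ((m : ℂ) ^ n * D ^ n * rowSum a b (m * z)) := by
      field_simp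
    rw [mul_left_comm, h3, h2, mul_add, Finset.mul_sum]
    congr 2
    · ring
    · refine Finset.sum_congr rfl fun j _ => ?_
      rw [mul_pow (m : ℂ) D j]
      ring
  have hx := norm_qq_lt_one z
  have hx' : ‖starRingEnd ℂ (qq z)‖ < 1 := by simpa using hx
  have h4 := ((hZ.hasSum.mul_left c₀).add (hasSum_sum (s := Finset.range (a + b)) fun j _ =>
    (((hasSum_lambert j n hx).mul_left (c j)).add
      ((hasSum_lambert j n hx').mul_left (c' j))).mul_left (D ^ j))).mul_left 2
  have h5 := ((funext hrow : _ = _) ▸ h1).unique h4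
  simp only [lambert_conj] at h5
  have h6 : ∑ j ∈ Finset.range (a + b), D ^ j * (2 * c j * lambert j n (qq z) +
      2 * c' j * starRingEnd ℂ (lambert j n (qq z))) =
      2 * ∑ j ∈ Finset.range (a + b), D ^ j * (c j * lambert j n (qq z) +
        c' j * starRingEnd ℂ (lambert j n (qq z))) := by
    rw [Finset.mul_sum]
    exact Finset.sum_congr rfl fun j _ => by ring
  rw [h6]
  linear_combination h5

/-! ### Expansions in `𝕃, q, q̄` and real analyticity -/

/-- `f` has an expansion in `ℂ[[q, q̄]][𝕃^±]` in which the powers of `𝕃` are at least `p`. -/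
def HasPoleExpansion (p : ℤ) (f : ℍ → ℂ) : Prop :=
  ∃ N a, HasExpansion f N a ∧ ∀ k < p, ∀ m n, a k m n = 0

lemma HasExpansion.extend {f : ℍ → ℂ} {N N' : ℕ} {a : ℤ → ℕ → ℕ → ℂ} (h : HasExpansion f N a)
    (hN : N ≤ N') :
    HasExpansion f N' (fun k => if k ∈ Finset.Icc (-(N : ℤ)) N then a k else 0) := by
  intro z
  obtain ⟨h1, h2⟩ := h z
  constructor
  · intro k _
    by_cases hk : k ∈ Finset.Icc (-(N : ℤ)) N
    · simpa only [hk, if_true] using h1 k hk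
    · simp only [hk, if_false]
      simp
  · rw [h2]
    have hsub : Finset.Icc (-(N : ℤ)) N ⊆ Finset.Icc (-(N' : ℤ)) N' :=
      Finset.Icc_subset_Icc (by omega) (by omega)
    rw [← Finset.sum_subset hsub]
    · refine Finset.sum_congr rfl fun k hk => ?_
      simp only [hk, if_true]
    · intro k _ hk
      simp only [hk, if_false]
      simp

lemma HasExpansion.add {f g : ℍ → ℂ} {N : ℕ} {a b : ℤ → ℕ → ℕ → ℂ} (hf : HasExpansion f N a)
    (hg : HasExpansion g N b) : HasExpansion (fun z => f z + g z) N (a + b) := by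
  intro z
  obtain ⟨h1, h2⟩ := hf z
  obtain ⟨h3, h4⟩ := hg z
  constructor
  · intro k hk
    simpa only [Pi.add_apply, add_mul] using (h1 k hk).add (h3 k hk)
  · simp only [h2, h4]
    rw [← Finset.sum_add_distrib]
    refine Finset.sum_congr rfl fun k hk => ?_
    rw [← mul_add, ← (h1 k hk).tsum_add (h3 k hk)]
    simp only [Pi.add_apply, add_mul]

lemma HasPoleExpansion.add {p : ℤ} {f g : ℍ → ℂ} (hf : HasPoleExpansion p f)
    (hg : HasPoleExpansion p g) : HasPoleExpansion p (fun z => f z + g z) := by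
  obtain ⟨N, a, h1, h2⟩ := hf
  obtain ⟨M, b, h3, h4⟩ := hg
  refine ⟨max N M, _, (h1.extend (le_max_left N M)).add (h3.extend (le_max_right N M)), ?_⟩
  intro k hk m n
  simp only [Pi.add_apply]
  split_ifs <;> simp [h2 k hk, h4 k hk]

lemma hasPoleExpansion_zero (p : ℤ) : HasPoleExpansion p fun _ => 0 :=
  ⟨0, 0, fun z => ⟨fun k _ => by simp, by simp⟩, by simp⟩

lemma hasPoleExpansion_of_hasSum {p k : ℤ} (hk : p ≤ k) {Q : ℍ → ℂ} (a : ℕ → ℕ → ℂ)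
    (h : ∀ z : ℍ, HasSum (fun p : ℕ × ℕ => a p.1 p.2 * qq z ^ p.1 * starRingEnd ℂ (qq z) ^ p.2)
      (Q z)) : HasPoleExpansion p fun z => LL z ^ k * Q z := by
  refine ⟨k.natAbs, Pi.single k a, fun z => ⟨fun l _ => ?_, ?_⟩, ?_⟩
  · by_cases hl : l = k
    · subst hl
      simpa using (h z).summable
    · simp [hl]
  · rw [Finset.sum_eq_single k]
    · simp [(h z).tsum_eq]
    · intro l _ hl
      simp [hl]
    · intro hk'
      simp only [Finset.mem_Icc] at hk'
      omega
  · intro l hl m n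
    rw [Pi.single_eq_of_ne (by omega)]
    rfl

lemma IsQSeries.hasPoleExpansion {p k : ℤ} (hk : p ≤ k) {Q : ℍ → ℂ} (hQ : IsQSeries Q) :
    HasPoleExpansion p fun z => LL z ^ k * Q z := by
  obtain ⟨α, h⟩ := hQ
  refine hasPoleExpansion_of_hasSum hk (fun m n => if n = 0 then α m else 0) fun z => ?_
  have hinj : Function.Injective fun m : ℕ => (m, 0) := fun x y hxy => by simpa using hxy
  rw [← hinj.hasSum_iff]
  · simpa [Function.comp_def] using h z
  · rintro ⟨m, n⟩ hmn
    have : n ≠ 0 := fun hn => hmn ⟨m, by simp [hn]⟩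
    simp [this]

lemma IsQSeries.hasPoleExpansion_conj {p k : ℤ} (hk : p ≤ k) {Q : ℍ → ℂ} (hQ : IsQSeries Q) :
    HasPoleExpansion p fun z => LL z ^ k * starRingEnd ℂ (Q z) := by
  obtain ⟨α, h⟩ := hQ
  refine hasPoleExpansion_of_hasSum hk (fun m n => if m = 0 then starRingEnd ℂ (α n) else 0)
    fun z => ?_
  have hinj : Function.Injective fun n : ℕ => (0, n) := fun x y hxy => by simpa using hxy
  rw [← hinj.hasSum_iff]
  · have := Complex.conjCLE.hasSum'.mpr (h z)
    simpa [Function.comp_def] using this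
  · rintro ⟨m, n⟩ hmn
    have : m ≠ 0 := fun hm => hmn ⟨n, by simp [hm]⟩
    simp [this]

lemma IsRealAnalytic.add {f g : ℍ → ℂ} (hf : IsRealAnalytic f) (hg : IsRealAnalytic g) :
    IsRealAnalytic fun z => f z + g z := fun u hu => (hf u hu).fun_add (hg u hu)

lemma IsRealAnalytic.mul {f g : ℍ → ℂ} (hf : IsRealAnalytic f) (hg : IsRealAnalytic g) :
    IsRealAnalytic fun z => f z * g z := fun u hu => (hf u hu).fun_mul (hg u hu)

lemma isRealAnalytic_const (c : ℂ) : IsRealAnalytic fun _ => c := fun _ _ => analyticAt_const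

lemma IsRealAnalytic.conj {f : ℍ → ℂ} (hf : IsRealAnalytic f) :
    IsRealAnalytic fun z => starRingEnd ℂ (f z) := fun u hu =>
  ((Complex.conjCLE : ℂ →L[ℝ] ℂ).analyticAt _).comp (hf u hu)

lemma isRealAnalytic_of_eqOn {f : ℍ → ℂ} {g : ℂ → ℂ} (hg : AnalyticOnNhd ℝ g {u : ℂ | 0 < u.im})
    (h : ∀ z : ℍ, f z = g z) : IsRealAnalytic f := by
  intro u hu
  refine (hg u hu).congr ?_
  filter_upwards [(isOpen_lt continuous_const Complex.continuous_im).mem_nhds hu] with v hv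
  rw [h, ofComplex_apply_of_im_pos hv]

lemma isRealAnalytic_LL_zpow (k : ℤ) : IsRealAnalytic fun z => LL z ^ k := by
  have h : IsRealAnalytic LL := by
    refine isRealAnalytic_of_eqOn
      (g := fun u => Complex.I * Real.pi * (u - starRingEnd ℂ u)) (fun u _ => ?_) fun z => rfl
    exact analyticAt_const.fun_mul
      (analyticAt_id.fun_sub ((Complex.conjCLE : ℂ →L[ℝ] ℂ).analyticAt _))
  exact fun u hu => (h u hu).fun_zpow (LL_ne_zero _)

/-- On `Im v > B` every term is dominated by its norm at `iB`, where the series converges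
absolutely; the sum is therefore holomorphic. -/
lemma IsQSeries.isRealAnalytic {Q : ℍ → ℂ} (hQ : IsQSeries Q) : IsRealAnalytic Q := by
  obtain ⟨α, h⟩ := hQ
  let F : ℕ → ℂ → ℂ := fun n u => α n * Complex.exp (2 * Real.pi * Complex.I * u) ^ n
  have hd : DifferentiableOn ℂ (fun u => ∑' n, F n u) {u : ℂ | 0 < u.im} := by
    intro u hu
    have hu' : 0 < u.im := hu
    set B := u.im / 2 with hB
    have hB0 : 0 < B := by positivity
    have him : 0 < (B * Complex.I : ℂ).im := by simpa using hB0
    have hs := (h ⟨B * Complex.I, him⟩).summable.norm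
    have hopen : IsOpen {v : ℂ | B < v.im} := isOpen_lt continuous_const Complex.continuous_im
    have := Complex.differentiableOn_tsum_of_summable_norm (F := F) hs
      (fun n => by fun_prop) hopen (fun n v hv => by
        simp only [F, qq, norm_mul, norm_pow, Complex.norm_exp]
        have h2 : B ≤ v.im := le_of_lt hv
        have h3 : (2 * Real.pi * Complex.I * v).re ≤
            (2 * Real.pi * Complex.I * (B * Complex.I)).re := by
          simp
          gcongr
        exact mul_le_mul_of_nonneg_left
          (pow_le_pow_left₀ (Real.exp_nonneg _) (Real.exp_le_exp.mpr h3) n) (norm_nonneg _))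
    exact (this.differentiableAt (hopen.mem_nhds (by simp [hB]; linarith))).differentiableWithinAt
  have ha := hd.analyticOnNhd (isOpen_lt continuous_const Complex.continuous_im)
  exact isRealAnalytic_of_eqOn (fun u hu => (ha u hu).restrictScalars) fun z => (h z).tsum_eq.symm

/-- The functions that are real analytic and have an expansion with powers of `𝕃` at least `p`. -/
def AnalyticExpansion (p : ℤ) (f : ℍ → ℂ) : Prop := IsRealAnalytic f ∧ HasPoleExpansion p f

lemma AnalyticExpansion.add {p : ℤ} {f g : ℍ → ℂ} (hf : AnalyticExpansion p f)
    (hg : AnalyticExpansion p g) : AnalyticExpansion p (fun z => f z + g z) :=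
  ⟨hf.1.add hg.1, hf.2.add hg.2⟩

lemma AnalyticExpansion.sum {p : ℤ} {ι : Type*} (s : Finset ι) {f : ι → ℍ → ℂ}
    (hf : ∀ i ∈ s, AnalyticExpansion p (f i)) : AnalyticExpansion p fun z => ∑ i ∈ s, f i z := by
  classical
  induction s using Finset.induction_on with
  | empty => simpa using ⟨isRealAnalytic_const 0, hasPoleExpansion_zero p⟩
  | insert i s hi ih =>
    simp only [Finset.sum_insert hi]
    exact (hf i (by simp)).add (ih fun j hj => hf j (by simp [hj]))

lemma IsQSeries.analyticExpansion {p k : ℤ} (hk : p ≤ k) {Q : ℍ → ℂ} (hQ : IsQSeries Q) :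
    AnalyticExpansion p fun z => LL z ^ k * Q z :=
  ⟨(isRealAnalytic_LL_zpow k).mul hQ.isRealAnalytic, hQ.hasPoleExpansion hk⟩

lemma IsQSeries.analyticExpansion_conj {p k : ℤ} (hk : p ≤ k) {Q : ℍ → ℂ} (hQ : IsQSeries Q) :
    AnalyticExpansion p fun z => LL z ^ k * starRingEnd ℂ (Q z) :=
  ⟨(isRealAnalytic_LL_zpow k).mul hQ.isRealAnalytic.conj, hQ.hasPoleExpansion_conj hk⟩

/-- Put `z - z̄ = 𝕃 / (iπ)` in `latSum_expansion` and divide by `(z - z̄)^(w+1)`. With the prefactor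
`𝕃`, the exponents of `𝕃` are `1` from `κ`, `-w` from `c₀`, and `j - w` with `0 ≤ j ≤ w + 1`, so all
are at least `-w`. -/
lemma analyticExpansion_eisFun (C : ℂ) {w r s : ℕ} (h : r + s = w) (hw : 1 ≤ w)
    (hw2 : Even w) : AnalyticExpansion (-(w : ℤ)) (eisFun C (r + 1) (s + 1)) := by
  have e1 : r + 1 + (s + 1) = w + 2 := by omega
  obtain ⟨κ, c₀, c, c', hexp⟩ := latSum_expansion (a := r + 1) (b := s + 1) (by omega)
    (by rw [e1]; exact hw2.add even_two)
  rw [e1] at hexp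
  have e2 : w + 2 - 1 = w + 1 := rfl
  rw [e2] at hexp
  set t : ℂ := Complex.I * Real.pi with ht
  have ht0 : t ≠ 0 := by simp [ht, Real.pi_ne_zero]
  have key : eisFun C (r + 1) (s + 1) = fun z =>
      LL z ^ (1 : ℤ) * (C * κ) + LL z ^ (-(w : ℤ)) * (C * t ^ (w + 1) * c₀) +
        ∑ j ∈ Finset.range (w + 2),
          (LL z ^ ((j : ℤ) - w) * (C * t ^ (w + 1) * (t ^ j)⁻¹ * c j * lambert j (w + 1) (qq z)) +
            LL z ^ ((j : ℤ) - w) * starRingEnd ℂ (starRingEnd ℂ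
              (C * t ^ (w + 1) * (t ^ j)⁻¹ * c' j) * lambert j (w + 1) (qq z))) := by
    funext z
    have hL := LL_ne_zero z
    have hD : (z : ℂ) - starRingEnd ℂ (z : ℂ) = LL z / t := by
      rw [LL, ← ht]
      field_simp
    have h1 := hexp z
    rw [hD] at h1
    have h2 : latSum (r + 1) (s + 1) z =
        t ^ (w + 1) / LL z ^ (w + 1) * ((LL z / t) ^ (w + 1) * latSum (r + 1) (s + 1) z) := by
      rw [div_pow]
      field_simp
    rw [eisFun, h2, h1]
    have hz : LL z * (LL z ^ (w + 1))⁻¹ = (LL z ^ w)⁻¹ := by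
      rw [pow_succ]
      field_simp
    have e3 : C * LL z * (t ^ (w + 1) / LL z ^ (w + 1) * (κ * (LL z / t) ^ (w + 1))) =
        LL z ^ (1 : ℤ) * (C * κ) := by
      rw [div_pow, zpow_one]
      field_simp
    have e4 : C * LL z * (t ^ (w + 1) / LL z ^ (w + 1) * c₀) =
        LL z ^ (-(w : ℤ)) * (C * t ^ (w + 1) * c₀) := by
      rw [zpow_neg, zpow_natCast, ← hz]
      ring
    rw [mul_add, mul_add, mul_add, mul_add, e3, e4, Finset.mul_sum, Finset.mul_sum]
    congr 1
    refine Finset.sum_congr rfl fun j _ => ?_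
    rw [zpow_sub₀ hL, zpow_natCast, zpow_natCast, div_eq_mul_inv (_ ^ j), ← hz, map_mul,
      Complex.conj_conj, div_pow]
    ring
  rw [key]
  refine (((isQSeries_const _).analyticExpansion (by omega)).add
    ((isQSeries_const _).analyticExpansion le_rfl)).add (AnalyticExpansion.sum _ fun j _ => ?_)
  exact (((isQSeries_lambert j (w + 1)).const_mul _).analyticExpansion (by omega)).add
    (((isQSeries_lambert j (w + 1)).const_mul _).analyticExpansion_conj (by omega))

lemma eisFun_mem (C : ℂ) {w r s : ℕ} (h : r + s = w) (hw : 1 ≤ w) (hw2 : Even w) :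
    eisFun C (r + 1) (s + 1) ∈ PM (-(w : ℤ)) r s := by
  obtain ⟨h1, N, a, h2, h3⟩ := analyticExpansion_eisFun C h hw hw2
  exact ⟨⟨h1, isModular_eisFun C r s, N, a, h2⟩, N, a, h2, h3⟩

/-! ### Wirtinger calculus for real analytic functions -/

lemma hasFDerivAt_wirtinger {f : ℍ → ℂ} (hf : IsRealAnalytic f) (z : ℍ) :
    HasFDerivAt (fun u : ℂ => f (ofComplex u)) (wirtingerCLM (wirtinger f z) (wirtingerBar f z))
      (z : ℂ) := by
  have h := (hf z z.2).differentiableAt.hasFDerivAt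
  refine h.congr_fderiv ?_
  set L := fderiv ℝ (fun u : ℂ => f (ofComplex u)) (z : ℂ) with hL
  ext1 k
  have hI := Complex.I_mul_I
  have h1 : L k = k.re * L 1 + k.im * L Complex.I := by
    have hk : k = k.re • (1 : ℂ) + k.im • Complex.I := by simp
    conv_lhs => rw [hk]
    rw [map_add, map_smul, map_smul, Complex.real_smul, Complex.real_smul]
  have h2 : starRingEnd ℂ k = k.re - k.im * Complex.I := by
    apply Complex.ext <;> simp
  rw [h1, wirtingerCLM_apply, wirtinger, wirtingerBar, ← hL, h2]
  conv_rhs => enter [1, 2]; rw [← Complex.re_add_im k]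
  linear_combination (L Complex.I * k.im) * hI

lemma partialOp_sub {f g : ℍ → ℂ} (hf : IsRealAnalytic f) (hg : IsRealAnalytic g) (r : ℤ) (z : ℍ) :
    partialOp r (fun z => f z - g z) z = partialOp r f z - partialOp r g z ∧
      partialBarOp r (fun z => f z - g z) z = partialBarOp r f z - partialBarOp r g z := by
  have h := wirtinger_eq (f := fun z => f z - g z)
    (g := fun u => f (ofComplex u) - g (ofComplex u)) (fun z => by simp)
    (A := wirtinger f z - wirtinger g z) (B := wirtingerBar f z - wirtingerBar g z) (z := z)
    (((hasFDerivAt_wirtinger hf z).fun_sub (hasFDerivAt_wirtinger hg z)).congr_fderiv (by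
      ext1 k
      simp only [wirtingerCLM_apply, sub_apply]
      ring))
  simp only [partialOp, partialBarOp, h.1, h.2]
  constructor <;> ring

lemma IsRealAnalytic.sub {f g : ℍ → ℂ} (hf : IsRealAnalytic f) (hg : IsRealAnalytic g) :
    IsRealAnalytic fun z => f z - g z := fun u hu => (hf u hu).fun_sub (hg u hu)

lemma IsModular.sub {r s : ℤ} {f g : ℍ → ℂ} (hf : IsModular r s f) (hg : IsModular r s g) :
    IsModular r s fun z => f z - g z := by
  intro γ z
  simp only [hf γ z, hg γ z]
  ring

lemma hasFDerivAt_wirtingerCLM_mul {f g : ℂ → ℂ} {A B A' B' u : ℂ}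
    (hf : HasFDerivAt f (wirtingerCLM A B) u) (hg : HasFDerivAt g (wirtingerCLM A' B') u) :
    HasFDerivAt (fun u => f u * g u)
      (wirtingerCLM (f u * A' + A * g u) (f u * B' + B * g u)) u := by
  refine (hf.fun_mul hg).congr_fderiv ?_
  ext1 k
  simp only [wirtingerCLM_apply, add_apply, smul_apply, smul_eq_mul]
  ring

lemma hasFDerivAt_wirtingerCLM_pow {f : ℂ → ℂ} {A B u : ℂ}
    (hf : HasFDerivAt f (wirtingerCLM A B) u) (n : ℕ) :
    HasFDerivAt (fun u => f u ^ n)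
      (wirtingerCLM (n * f u ^ (n - 1) * A) (n * f u ^ (n - 1) * B)) u := by
  refine (((hasDerivAt_pow n (f u)).hasFDerivAt.restrictScalars ℝ).comp u hf).congr_fderiv ?_
  ext1 k
  simp [wirtingerCLM_apply]
  ring

lemma hasFDerivAt_wirtingerCLM_sum {ι : Type*} (s : Finset ι) {f : ι → ℂ → ℂ} {A B : ι → ℂ} {u : ℂ}
    (hf : ∀ i ∈ s, HasFDerivAt (f i) (wirtingerCLM (A i) (B i)) u) :
    HasFDerivAt (fun u => ∑ i ∈ s, f i u) (wirtingerCLM (∑ i ∈ s, A i) (∑ i ∈ s, B i)) u := by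
  refine (HasFDerivAt.fun_sum hf).congr_fderiv ?_
  ext1 k
  simp only [wirtingerCLM_apply, sum_apply, Finset.sum_mul, Finset.sum_add_distrib]

/-! ### Uniqueness through an invariant binary form -/

/-- The value at `z` of the binary form `∑ G_i(z) (X - zY)^i (X - z̄Y)^(w-i)`. -/
def binaryForm (w : ℕ) (G : ℕ → ℍ → ℂ) (X Y : ℂ) (z : ℍ) : ℂ :=
  ∑ i ∈ Finset.range (w + 1), G i z * (X - z * Y) ^ i *
    (X - starRingEnd ℂ (z : ℂ) * Y) ^ (w - i)

/-- An index shift that makes the two contributions to the `z`-derivative of the binary form cancel: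
the left side comes from the system, the right side from differentiating `p^i`. -/
lemma sum_partial_eq (w : ℕ) (g : ℕ → ℂ) (hg : g (w + 1) = 0) (p q : ℂ) :
    ∑ i ∈ Finset.range (w + 1), ((i : ℂ) + 1) * g (i + 1) * p ^ i * q ^ (w - i) =
      ∑ i ∈ Finset.range (w + 1), (i : ℂ) * g i * p ^ (i - 1) * q ^ (w - i + 1) := by
  rw [Finset.sum_range_succ, Finset.sum_range_succ', hg]
  simp only [mul_zero, zero_mul, add_zero, Nat.cast_zero]
  refine Finset.sum_congr rfl fun i hi => ?_
  have hi' := Finset.mem_range.mp hi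
  rw [show w - (i + 1) + 1 = w - i by omega, Nat.add_sub_cancel]
  push_cast
  ring

lemma sum_partialBar_eq (w : ℕ) (g b : ℕ → ℂ) (hb : b 0 = 0)
    (hb' : ∀ i < w, b (i + 1) = (w - i : ℕ) * g i) (p q : ℂ) :
    ∑ i ∈ Finset.range (w + 1), b i * p ^ i * q ^ (w - i) =
      ∑ i ∈ Finset.range (w + 1), ((w - i : ℕ) : ℂ) * g i * p ^ (i + 1) * q ^ (w - i - 1) := by
  rw [Finset.sum_range_succ', Finset.sum_range_succ, hb]
  simp only [zero_mul, add_zero, Nat.cast_zero, Nat.sub_self]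
  refine Finset.sum_congr rfl fun i hi => ?_
  rw [hb' i (Finset.mem_range.mp hi), Nat.sub_sub]

/-- The homogeneous version of the system satisfied by the real analytic Eisenstein series. -/
structure IsHomogeneousFamily (w : ℕ) (G : ℕ → ℍ → ℂ) : Prop where
  analytic : ∀ i ≤ w, IsRealAnalytic (G i)
  modular : ∀ i ≤ w, IsModular i (w - i : ℕ) (G i)
  top : ∀ z, G (w + 1) z = 0
  partial_eq : ∀ i ≤ w, ∀ z, partialOp i (G i) z = ((i : ℂ) + 1) * G (i + 1) z
  partialBar_zero : ∀ z, partialBarOp w (G 0) z = 0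
  partialBar_succ : ∀ i < w, ∀ z,
    partialBarOp (w - (i + 1) : ℕ) (G (i + 1)) z = (w - i : ℕ) * G i z

variable {w : ℕ} {G : ℕ → ℍ → ℂ}

/-- After multiplication by `z - z̄`, the relation `(z - z̄)Y = q - p` turns the derivative of `p^i`
into the weight term of `∂` minus a shifted term, and the shifted terms cancel against the
right-hand sides of the system. The `z̄`-derivative is symmetric. -/
lemma IsHomogeneousFamily.hasFDerivAt_binaryForm (h : IsHomogeneousFamily w G) (X Y : ℂ) (z : ℍ) :
    HasFDerivAt (fun u : ℂ => binaryForm w G X Y (ofComplex u)) (0 : ℂ →L[ℝ] ℂ) (z : ℂ) := by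
  set p := X - z * Y with hp
  set q := X - starRingEnd ℂ (z : ℂ) * Y with hq
  have hzz : (z : ℂ) - starRingEnd ℂ (z : ℂ) ≠ 0 := by
    intro h0
    apply LL_ne_zero z
    rw [LL, h0, mul_zero]
  have dp : HasFDerivAt (fun u : ℂ => X - u * Y) (wirtingerCLM (-Y) 0) (z : ℂ) := by
    have e : (fun u : ℂ => X - u * Y) = fun u => X + wirtingerCLM (-Y) 0 u := by
      ext u
      rw [wirtingerCLM_apply]
      ring
    rw [e]
    exact (ContinuousLinearMap.hasFDerivAt _).const_add X
  have dq : HasFDerivAt (fun u : ℂ => X - starRingEnd ℂ u * Y) (wirtingerCLM 0 (-Y)) (z : ℂ) := by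
    have e : (fun u : ℂ => X - starRingEnd ℂ u * Y) = fun u => X + wirtingerCLM 0 (-Y) u := by
      ext u
      rw [wirtingerCLM_apply]
      ring
    rw [e]
    exact (ContinuousLinearMap.hasFDerivAt _).const_add X
  have key := hasFDerivAt_wirtingerCLM_sum (Finset.range (w + 1)) fun i hi =>
    hasFDerivAt_wirtingerCLM_mul (hasFDerivAt_wirtingerCLM_mul
      (hasFDerivAt_wirtinger (h.analytic i (Nat.lt_succ_iff.mp (Finset.mem_range.mp hi))) z)
      (hasFDerivAt_wirtingerCLM_pow dp i)) (hasFDerivAt_wirtingerCLM_pow dq (w - i))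
  have heq : (fun u : ℂ => binaryForm w G X Y (ofComplex u)) =ᶠ[nhds (z : ℂ)] fun u =>
      ∑ i ∈ Finset.range (w + 1), G i (ofComplex u) * (X - u * Y) ^ i *
        (X - starRingEnd ℂ u * Y) ^ (w - i) := by
    filter_upwards [(isOpen_lt continuous_const Complex.continuous_im).mem_nhds z.2] with u hu
    rw [binaryForm, ofComplex_apply_of_im_pos hu]
  refine (key.congr_of_eventuallyEq heq).congr_fderiv ?_
  simp only [ofComplex_apply, ← hp, ← hq, mul_zero, zero_add]
  have hA : ∑ i ∈ Finset.range (w + 1), (G i z * (i * p ^ (i - 1) * -Y) + wirtinger (G i) z * p ^ i)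
      * q ^ (w - i) = 0 := by
    refine (mul_eq_zero.mp ?_).resolve_left hzz
    rw [Finset.mul_sum]
    have hsum := sum_partial_eq w (fun i => G i z) (h.top z) p q
    rw [← sub_eq_zero, ← Finset.sum_sub_distrib] at hsum
    rw [← hsum]
    refine Finset.sum_congr rfl fun i hi => ?_
    have h1 := h.partial_eq i (Nat.lt_succ_iff.mp (Finset.mem_range.mp hi)) z
    rw [partialOp] at h1
    rw [← h1]
    have h2 : ((z : ℂ) - starRingEnd ℂ (z : ℂ)) * Y = q - p := by rw [hp, hq]; ring
    rcases i with _ | i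
    · simp
      ring
    · rw [Nat.add_sub_cancel]
      push_cast
      linear_combination (-(G (i + 1) z * (i + 1) * p ^ i * q ^ (w - (i + 1)))) * h2
  have hB : ∑ i ∈ Finset.range (w + 1), (G i z * p ^ i * ((w - i : ℕ) * q ^ (w - i - 1) * -Y) +
      wirtingerBar (G i) z * p ^ i * q ^ (w - i)) = 0 := by
    have hzz' : starRingEnd ℂ (z : ℂ) - z ≠ 0 := by
      rw [← neg_sub]
      exact neg_ne_zero.mpr hzz
    refine (mul_eq_zero.mp ?_).resolve_left hzz'
    rw [Finset.mul_sum]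
    have hsum := sum_partialBar_eq w (fun i => G i z)
      (fun i => partialBarOp (w - i : ℕ) (G i) z) (h.partialBar_zero z)
      (fun i hi => h.partialBar_succ i hi z) p q
    rw [← sub_eq_zero, ← Finset.sum_sub_distrib] at hsum
    rw [← hsum]
    refine Finset.sum_congr rfl fun i hi => ?_
    rw [partialBarOp]
    have h2 : (starRingEnd ℂ (z : ℂ) - z) * Y = p - q := by rw [hp, hq]; ring
    generalize w - i = n
    rcases n with _ | n
    · simp
      ring
    · rw [Nat.add_sub_cancel]
      push_cast
      linear_combination (-(G i z * (n + 1) * p ^ i * q ^ n)) * h2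
  simp only [hA, hB]
  ext1 k
  simp [wirtingerCLM_apply]

lemma IsHomogeneousFamily.binaryForm_const (h : IsHomogeneousFamily w G) (X Y : ℂ) (z z' : ℍ) :
    binaryForm w G X Y z = binaryForm w G X Y z' := by
  have hs : IsOpen {u : ℂ | 0 < u.im} := isOpen_lt continuous_const Complex.continuous_im
  have hd : ∀ u ∈ {u : ℂ | 0 < u.im},
      HasFDerivAt (fun u : ℂ => binaryForm w G X Y (ofComplex u)) (0 : ℂ →L[ℝ] ℂ) u :=
    fun u hu => h.hasFDerivAt_binaryForm X Y ⟨u, hu⟩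
  have := hs.is_const_of_fderiv_eq_zero (𝕜 := ℝ) (convex_halfSpace_im_gt 0).isPreconnected
    (fun u hu => (hd u hu).differentiableAt.differentiableWithinAt)
    (fun u hu => (hd u hu).fderiv) z.2 z'.2
  simpa using this

/-- The automorphy factors are absorbed by the linear forms: `(cz + d)(X - γz Y) = (dX - bY) - z(aY
- cX)`, and likewise for `z̄`. -/
lemma IsHomogeneousFamily.binaryForm_smul (h : IsHomogeneousFamily w G) (X Y : ℂ)
    (γ : Matrix.SpecialLinearGroup (Fin 2) ℤ) (z : ℍ) :
    binaryForm w G X Y (γ • z) =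
      binaryForm w G (γ 1 1 * X - γ 0 1 * Y) (γ 0 0 * Y - γ 1 0 * X) z := by
  refine Finset.sum_congr rfl fun i hi => ?_
  rw [h.modular i (Nat.lt_succ_iff.mp (Finset.mem_range.mp hi)) γ z, zpow_natCast, zpow_natCast]
  have hd : (γ 1 0 : ℂ) * z + γ 1 1 ≠ 0 := by
    have := denom_ne_zero γ z
    rwa [ModularGroup.denom_apply] at this
  have hz : ((γ • z : ℍ) : ℂ) = ((γ 0 0 : ℂ) * z + γ 0 1) / ((γ 1 0 : ℂ) * z + γ 1 1) := by
    rw [UpperHalfPlane.specialLinearGroup_apply]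
    simp
  have e1 : ((γ 1 0 : ℂ) * z + γ 1 1) * (X - ((γ • z : ℍ) : ℂ) * Y) =
      γ 1 1 * X - γ 0 1 * Y - z * (γ 0 0 * Y - γ 1 0 * X) := by
    rw [hz]
    field_simp
    ring
  have e3 : ((γ 1 0 : ℂ) * starRingEnd ℂ (z : ℂ) + γ 1 1) *
      (X - starRingEnd ℂ ((γ • z : ℍ) : ℂ) * Y) =
      γ 1 1 * X - γ 0 1 * Y - starRingEnd ℂ (z : ℂ) * (γ 0 0 * Y - γ 1 0 * X) := by
    have hd' : (γ 1 0 : ℂ) * starRingEnd ℂ (z : ℂ) + γ 1 1 ≠ 0 := by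
      have := (map_ne_zero (starRingEnd ℂ)).mpr hd
      simpa using this
    rw [hz]
    simp only [map_div₀, map_add, map_mul, map_intCast]
    field_simp
    ring
  rw [← e1, ← e3, mul_pow, mul_pow]
  ring

lemma binaryForm_mul (c X Y : ℂ) (z : ℍ) :
    binaryForm w G (c * X) (c * Y) z = c ^ w * binaryForm w G X Y z := by
  rw [binaryForm, binaryForm, Finset.mul_sum]
  refine Finset.sum_congr rfl fun i hi => ?_
  have hi' : i ≤ w := Nat.lt_succ_iff.mp (Finset.mem_range.mp hi)
  rw [show c * X - z * (c * Y) = c * (X - z * Y) by ring,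
    show c * X - starRingEnd ℂ (z : ℂ) * (c * Y) = c * (X - starRingEnd ℂ (z : ℂ) * Y) by ring,
    mul_pow, mul_pow]
  nth_rewrite 3 [← Nat.add_sub_cancel' hi']
  rw [pow_add]
  ring

/-- Write `F` for the form. Invariance under `T` gives `F(n, 1) = F(0, 1)`, so by homogeneity `F(1,
1/n) = n^(-w) F(0, 1)`, which tends to 0; hence `F(1, 0) = 0` by continuity, and `S` carries this to
`F(0, 1) = 0`. -/
lemma IsHomogeneousFamily.binaryForm_nat (h : IsHomogeneousFamily w G) (hw : 1 ≤ w) (n : ℕ)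
    (z : ℍ) : binaryForm w G n 1 z = 0 := by
  have hT : ∀ X Y, binaryForm w G X Y z = binaryForm w G (X - Y) Y z := fun X Y => by
    have := h.binaryForm_smul X Y ModularGroup.T z
    rw [h.binaryForm_const X Y _ z] at this
    simpa [ModularGroup.T] using this
  have hS : ∀ X Y, binaryForm w G X Y z = binaryForm w G Y (-X) z := fun X Y => by
    have := h.binaryForm_smul X Y ModularGroup.S z
    rw [h.binaryForm_const X Y _ z] at this
    simpa [ModularGroup.S] using this
  have hn : ∀ n : ℕ, binaryForm w G n 1 z = binaryForm w G 0 1 z := by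
    intro n
    induction n with
    | zero => simp
    | succ n ih =>
      rw [hT, ← ih]
      simp
  have hlim : Filter.Tendsto (fun n : ℕ => binaryForm w G 1 ((n : ℂ)⁻¹) z) Filter.atTop
      (nhds (binaryForm w G 1 0 z)) := by
    have hc : Continuous fun Y => binaryForm w G 1 Y z := by
      unfold binaryForm
      fun_prop
    exact (hc.tendsto 0).comp (tendsto_inv_atTop_nhds_zero_nat (𝕜 := ℂ))
  have hlim2 : Filter.Tendsto (fun n : ℕ => ((n : ℂ)⁻¹) ^ w * binaryForm w G 0 1 z) Filter.atTop
      (nhds (0 ^ w * binaryForm w G 0 1 z)) :=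
    ((tendsto_inv_atTop_nhds_zero_nat (𝕜 := ℂ)).pow w).mul_const _
  have heq : (fun n : ℕ => ((n : ℂ)⁻¹) ^ w * binaryForm w G 0 1 z) =ᶠ[Filter.atTop]
      fun n : ℕ => binaryForm w G 1 ((n : ℂ)⁻¹) z := by
    filter_upwards [Filter.eventually_gt_atTop 0] with n hn0
    have : (n : ℂ) ≠ 0 := by exact_mod_cast hn0.ne'
    rw [← hn n, ← binaryForm_mul, inv_mul_cancel₀ this, mul_one]
  have h0 := tendsto_nhds_unique (hlim2.congr' heq) hlim
  rw [zero_pow (by omega), zero_mul] at h0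
  have h1 := hS 0 1
  rw [neg_zero, ← h0] at h1
  rw [hn, h1]

/-- Dividing `F(n, 1)` by `(n - z̄)^w` gives the polynomial with coefficients `G_j(z)` evaluated at
`(n - z) / (n - z̄)`. These points are distinct because `z ≠ z̄`, so the polynomial has infinitely
many roots. -/
theorem IsHomogeneousFamily.eq_zero (h : IsHomogeneousFamily w G) (hw : 1 ≤ w) {i : ℕ}
    (hi : i ≤ w) (z : ℍ) : G i z = 0 := by
  let P : Polynomial ℂ := ∑ j ∈ Finset.range (w + 1), Polynomial.C (G j z) * Polynomial.X ^ j
  have hzz : (z : ℂ) - starRingEnd ℂ (z : ℂ) ≠ 0 := by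
    intro h0
    apply LL_ne_zero z
    rw [LL, h0, mul_zero]
  have hne : ∀ n : ℕ, (n : ℂ) - starRingEnd ℂ (z : ℂ) ≠ 0 := by
    intro n hn
    have := congrArg Complex.im hn
    simp at this
    exact z.im_ne_zero this
  let T : ℕ → ℂ := fun n => (n - z) / (n - starRingEnd ℂ (z : ℂ))
  have hTinj : Function.Injective T := by
    intro m n hmn
    have hm := hne m
    have hn := hne n
    simp only [T] at hmn
    rw [div_eq_div_iff hm hn] at hmn
    have : ((z : ℂ) - starRingEnd ℂ (z : ℂ)) * (m - n) = 0 := by linear_combination hmn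
    have := (mul_eq_zero.mp this).resolve_left hzz
    exact_mod_cast sub_eq_zero.mp this
  have hroot : ∀ n, P.IsRoot (T n) := by
    intro n
    have hb := h.binaryForm_nat hw n z
    have hn := hne n
    have e : P.eval (T n) * (n - starRingEnd ℂ (z : ℂ)) ^ w = binaryForm w G n 1 z := by
      simp only [P, Polynomial.eval_finsetSum, Polynomial.eval_mul, Polynomial.eval_C,
        Polynomial.eval_pow, Polynomial.eval_X]
      rw [binaryForm, Finset.sum_mul]
      refine Finset.sum_congr rfl fun j hj => ?_
      have hj' : j ≤ w := Nat.lt_succ_iff.mp (Finset.mem_range.mp hj)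
      conv_lhs => rw [← Nat.add_sub_cancel' hj', pow_add]
      simp only [T, mul_one, div_pow]
      field_simp
    rw [hb] at e
    exact (mul_eq_zero.mp e).resolve_right (pow_ne_zero _ hn)
  have hP : P = 0 := Polynomial.eq_zero_of_infinite_isRoot P
    ((Set.infinite_range_of_injective hTinj).mono (by rintro _ ⟨n, rfl⟩; exact hroot n))
  have hc : P.coeff i = G i z := by
    simp only [P, Polynomial.finsetSum_coeff, Polynomial.coeff_C_mul_X_pow]
    simp
    omega
  rw [← hc, hP, Polynomial.coeff_zero]

lemma IsEisensteinFamily.unique {w : ℕ} (hw : 1 ≤ w) {E E' : (r s : ℕ) → r + s = w → ℍ → ℂ}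
    (hE : IsEisensteinFamily w E) (hE' : IsEisensteinFamily w E') : E = E' := by
  -- The value 0 beyond `w` makes the equation for `∂G_w` an instance of the general one.
  let G : ℕ → ℍ → ℂ := fun i z =>
    if h : i ≤ w then E i (w - i) (Nat.add_sub_cancel' h) z - E' i (w - i) (Nat.add_sub_cancel' h) z
    else 0
  have hG : ∀ (r s : ℕ) (h : r + s = w), G r = fun z => E r s h z - E' r s h z := by
    intro r s h
    obtain rfl : s = w - r := by omega
    have hr : r ≤ w := by omega
    funext z
    simp only [G, hr, dif_pos]
  have hfam : IsHomogeneousFamily w G := by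
    refine ⟨fun i hi => ?_, fun i hi => ?_, fun z => by simp [G], fun i hi z => ?_, fun z => ?_,
      fun i hi z => ?_⟩
    · rw [hG i (w - i) (by omega)]
      exact (hE.mem _ _ _).1.1.sub (hE'.mem _ _ _).1.1
    · rw [hG i (w - i) (by omega)]
      exact (hE.mem _ _ _).1.2.1.sub (hE'.mem _ _ _).1.2.1
    · rcases hi.lt_or_eq with hlt | rfl
      · obtain ⟨s, hs⟩ : ∃ s, i + (s + 1) = w := ⟨w - i - 1, by omega⟩
        rw [hG i (s + 1) hs, hG (i + 1) s (by omega),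
          (partialOp_sub (hE.mem _ _ _).1.1 (hE'.mem _ _ _).1.1 _ z).1, hE.partial_step,
          hE'.partial_step]
        ring
      · rw [hG i 0 (by omega), (partialOp_sub (hE.mem _ _ _).1.1 (hE'.mem _ _ _).1.1 _ z).1,
          hE.partial_last, hE'.partial_last]
        simp [G]
    · rw [hG 0 w (by omega), (partialOp_sub (hE.mem _ _ _).1.1 (hE'.mem _ _ _).1.1 _ z).2,
        hE.partialBar_last, hE'.partialBar_last, sub_self]
    · obtain ⟨s, rfl⟩ : ∃ s, w = i + 1 + s := ⟨w - (i + 1), by omega⟩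
      rw [hG (i + 1) s rfl, hG i (s + 1) (by omega), Nat.add_sub_cancel_left,
        (partialOp_sub (hE.mem _ _ _).1.1 (hE'.mem _ _ _).1.1 _ z).2, hE.partialBar_step,
        hE'.partialBar_step, show i + 1 + s - i = s + 1 by omega]
      push_cast
      ring
  funext r s h z
  have := hfam.eq_zero hw (i := r) (by omega) z
  rw [hG r s h] at this
  exact sub_eq_zero.mp this

/-! ### The explicit solution -/

/-- The normalising constant `w! / (2πi)^(w+2) / 2`. -/
def eisConst (w : ℕ) : ℂ := (w.factorial : ℂ) / (2 * Real.pi * Complex.I) ^ (w + 2) * (1 / 2)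

lemma isEisensteinFamily_eisFun {w : ℕ} (hw : 1 ≤ w) (hw2 : Even w) :
    IsEisensteinFamily w fun r s _ => eisFun (eisConst w) (r + 1) (s + 1) := by
  have hlast : ∀ z : ℍ, ((w : ℂ) + 1) * eisConst w * latSum (w + 2) 0 z = GG (w + 2) z := by
    intro z
    rw [← latSum_zero_right hw hw2, eisConst, Nat.factorial_succ]
    push_cast
    ring
  -- The constant is real because `w + 2` is even, so the equation for `∂̄` is the conjugate of the
  -- one for `∂`.
  have hconst : starRingEnd ℂ (eisConst w) = eisConst w := by
    have : (-(2 * Real.pi * Complex.I)) ^ (w + 2) = (2 * Real.pi * Complex.I : ℂ) ^ (w + 2) :=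
      (hw2.add even_two).neg_pow _
    simp [eisConst, map_ofNat, ← this]
  refine ⟨fun r s h => eisFun_mem _ h hw hw2, fun z => ?_, fun r s h z => ?_, fun z => ?_,
    fun r s h z => ?_⟩
  · rw [partialOp_eisFun _ w 0 (by omega), ← hlast, eisFun]
    ring
  · exact partialOp_eisFun _ r (s + 1) (by omega) z
  · rw [partialBarOp_eisFun _ 0 w (by omega), ← hlast, eisFun, latSum_conj (w + 2) 0]
    simp only [map_mul, map_add, map_natCast, map_one, hconst]
    ring
  · exact partialBarOp_eisFun _ (r + 1) s (by omega) z

lemma hasSum_eisFun (c : ℂ) {a b : ℕ} (hab : 3 ≤ a + b) (z : ℍ) :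
    HasSum (fun p : {p : ℤ × ℤ // p ≠ (0, 0)} => c * (LL z /
      (((p.1.1 : ℂ) * (z : ℂ) + (p.1.2 : ℂ)) ^ a *
        ((p.1.1 : ℂ) * starRingEnd ℂ (z : ℂ) + (p.1.2 : ℂ)) ^ b))) (eisFun c a b z) := by
  have h1 : HasSum (fun p : ℤ × ℤ => latTerm a b ![p.1, p.2] z) (latSum a b z) :=
    (finTwoArrowEquiv ℤ).symm.hasSum_iff.mpr (summable_latTerm hab z.2).hasSum
  have h2 := h1.mul_left (c * LL z)
  -- The origin contributes 0 to `latSum` because `0⁻¹ = 0` and `a`, `b` are not both 0; it can be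
  -- dropped from the index set.
  have hsupp : Function.support (fun p : ℤ × ℤ => c * LL z * latTerm a b ![p.1, p.2] z) ⊆
      {p | p ≠ (0, 0)} := by
    intro p hp h0
    apply hp
    have hp0 : p = (0, 0) := h0
    have hab0 : ¬a = 0 ∨ ¬b = 0 := by omega
    simp only [hp0, latTerm]
    simp [hab0]
  convert! (hasSum_subtype_iff_of_support_subset hsupp).mpr h2 using 2 with p
  simp [latTerm, div_eq_mul_inv]
  ring

end RealAnalyticEisenstein

end

theorem mainTheorem4 (w : ℕ) (hw : 1 ≤ w) (hw_even : Even w) :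
    (∃! E : (r s : ℕ) → r + s = w → UpperHalfPlane → ℂ,
      RealAnalyticEisenstein.IsEisensteinFamily w E) ∧
    ∀ E : (r s : ℕ) → r + s = w → UpperHalfPlane → ℂ,
      RealAnalyticEisenstein.IsEisensteinFamily w E →
      ∀ (r s : ℕ) (h : r + s = w) (z : UpperHalfPlane),
        HasSum (fun p : {p : ℤ × ℤ // p ≠ (0, 0)} =>
          (w.factorial : ℂ) / (2 * Real.pi * Complex.I) ^ (w + 2) * (1 / 2) *
            (RealAnalyticEisenstein.LL z /
              (((p.1.1 : ℂ) * (z : ℂ) + (p.1.2 : ℂ)) ^ (r + 1) *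
                ((p.1.1 : ℂ) * starRingEnd ℂ (z : ℂ) + (p.1.2 : ℂ)) ^ (s + 1))))
          (E r s h z) := by
  have hE₀ := RealAnalyticEisenstein.isEisensteinFamily_eisFun hw hw_even
  refine ⟨⟨_, hE₀, fun E hE => hE.unique hw hE₀⟩, fun E hE r s h z => ?_⟩
  rw [hE.unique hw hE₀]
  exact RealAnalyticEisenstein.hasSum_eisFun _ (by omega) z
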